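/- Over the field $\mathbb F_2$, let $\mathfrak m_0(n)$ be the $n$-dimensional Lie algebra with basis $e_1,\dots,e_n$ and nonzero brackets $[e_1,e_i]=e_{i+1}$ for $1<i<n$, and let $\mathfrak m_2(n)$ be the Lie algebra with basis $e_1,\dots,e_n$ and nonzero brackets $[e_1,e_i]=e_{i+1}$ for $1<i<n$ and $[e_2,e_j]=e_{j+2}$ for $2<j<n-1$ (brackets of basis vectors not determined by these through skew-symmetry are zero). For a finite-dimensional Lie algebra $\mathfrak g$ over $\mathbb F_2$ let $d$ be the derivation of the exterior algebra $\Lambda(\mathfrak g^*)$ with $d\xi(X,Y)=\xi([X,Y])$ for $\xi\in\mathfrak g^*$, and let $b_q(\mathfrak g)=\dim\,\ker(d:\Lambda^q\to\Lambda^{q+1})/\operatorname{im}(d:\Lambda^{q-1}\to\Lambda^q)$ be the $q$-th Betti number. Then for every $n\ge 5$ we have $b_q(\mathfrak m_2(n))=b_q(\mathfrak m_0(n))$ for $q=1,2,3$, and $$b_1(\mathfrak m_2(n))=2,\qquad b_2(\mathfrak m_2(n))=\left\lfloor\tfrac{n+1}{2}\right\rfloor,$$ $$b_3(\mathfrak m_2(n))=\tfrac13(2^p-1)(2^{p-1}-1)+\tfrac12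 m(m-1)+\left\lfloor\tfrac{n-1}{2}\right\rfloor,$$ where $p$ and $m$ are the integers with $n=2^p+m$ and $0<m\le 2^p$. -/

import Mathlib

/-! ## The Lie algebras `𝔪₀(n)` and `𝔪₂(n)` over `𝔽₂`

The underlying space is `Fin n → ZMod 2`; the vector written `e_i` (`1 ≤ i ≤ n`) in the mathematics
is the standard basis vector of index `i - 1 : Fin n`. -/

/-- The Lie algebra `𝔪₀(n) = Span (e₁, …, eₙ)` over `𝔽₂`, with `[e₁, e_i] = e_{i+1}` for
`1 < i < n`. -/
def M0 (n : ℕ) : Type := Fin n → ZMod 2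

/-- The Lie algebra `𝔪₂(n) = Span (e₁, …, eₙ)` over `𝔽₂`, with `[e₁, e_i] = e_{i+1}` for
`1 < i < n` and `[e₂, e_j] = e_{j+2}` for `2 < j < n - 1`. -/
def M2 (n : ℕ) : Type := Fin n → ZMod 2

instance (n : ℕ) : AddCommGroup (M0 n) := inferInstanceAs (AddCommGroup (Fin n → ZMod 2))
instance (n : ℕ) : Module (ZMod 2) (M0 n) := inferInstanceAs (Module (ZMod 2) (Fin n → ZMod 2))
instance (n : ℕ) : AddCommGroup (M2 n) := inferInstanceAs (AddCommGroup (Fin n → ZMod 2))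
instance (n : ℕ) : Module (ZMod 2) (M2 n) := inferInstanceAs (Module (ZMod 2) (Fin n → ZMod 2))

/-- The standard basis `e₁, …, eₙ` of `𝔪₀(n)` (the vector `e_i` has index `i - 1`). -/
noncomputable def M0.basis (n : ℕ) : Module.Basis (Fin n) (ZMod 2) (M0 n) :=
  Pi.basisFun (ZMod 2) (Fin n)

/-- The standard basis `e₁, …, eₙ` of `𝔪₂(n)` (the vector `e_i` has index `i - 1`). -/
noncomputable def M2.basis (n : ℕ) : Module.Basis (Fin n) (ZMod 2) (M2 n) :=
  Pi.basisFun (ZMod 2) (Fin n)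

/-- The part `[e₁, e_i] = e_{i+1}` (`1 < i < n`) of the brackets, in coordinates: the coefficient of
`e_{k+1}` is `x₁ y_k - y₁ x_k` if `k ≥ 2`, and `0` otherwise. -/
def bracketOne {n : ℕ} (x y : Fin n → ZMod 2) : Fin n → ZMod 2 := fun k =>
  if _ : 2 ≤ k.val then
    x ⟨0, by omega⟩ * y ⟨k.val - 1, by omega⟩ - y ⟨0, by omega⟩ * x ⟨k.val - 1, by omega⟩
  else 0

/-- The part `[e₂, e_j] = e_{j+2}` (`2 < j < n - 1`) of the bracket, in coordinates: the coefficient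
of `e_{k+1}` is `x₂ y_{k-1} - y₂ x_{k-1}` if `k ≥ 4`, and `0` otherwise. -/
def bracketTwo {n : ℕ} (x y : Fin n → ZMod 2) : Fin n → ZMod 2 := fun k =>
  if _ : 4 ≤ k.val then
    x ⟨1, by omega⟩ * y ⟨k.val - 2, by omega⟩ - y ⟨1, by omega⟩ * x ⟨k.val - 2, by omega⟩
  else 0

instance (n : ℕ) : Bracket (M0 n) (M0 n) where
  bracket x y := bracketOne x y

instance (n : ℕ) : Bracket (M2 n) (M2 n) where
  bracket x y := fun k => bracketOne x y k + bracketTwo x y k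

theorem M0.bracket_apply {n : ℕ} (x y : M0 n) (k : Fin n) : ⁅x, y⁆ k = bracketOne x y k := rfl

theorem M2.bracket_apply {n : ℕ} (x y : M2 n) (k : Fin n) :
    ⁅x, y⁆ k = bracketOne x y k + bracketTwo x y k := rfl

theorem M0.basis_apply {n : ℕ} (i k : Fin n) : M0.basis n i k = if k = i then 1 else 0 := by
  change Pi.basisFun (ZMod 2) (Fin n) i k = _
  rw [Pi.basisFun_apply, Pi.single_apply]

theorem M2.basis_apply {n : ℕ} (i k : Fin n) : M2.basis n i k = if k = i then 1 else 0 := by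
  change Pi.basisFun (ZMod 2) (Fin n) i k = _
  rw [Pi.basisFun_apply, Pi.single_apply]

theorem M0.add_apply {n : ℕ} (x y : M0 n) (k : Fin n) : (x + y) k = x k + y k := rfl

theorem M2.add_apply {n : ℕ} (x y : M2 n) (k : Fin n) : (x + y) k = x k + y k := rfl

theorem M0.smul_apply {n : ℕ} (c : ZMod 2) (x : M0 n) (k : Fin n) : (c • x) k = c * x k := rfl

theorem M2.smul_apply {n : ℕ} (c : ZMod 2) (x : M2 n) (k : Fin n) : (c • x) k = c * x k := rfl

instance (n : ℕ) : LieRing (M0 n) where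
  add_lie x y z := by
    funext k
    simp only [M0.add_apply, M0.bracket_apply, bracketOne]
    split_ifs
    · ring
    · simp
  lie_add x y z := by
    funext k
    simp only [M0.add_apply, M0.bracket_apply, bracketOne]
    split_ifs
    · ring
    · simp
  lie_self x := by
    funext k
    change _ = (0 : ZMod 2)
    simp only [M0.bracket_apply, bracketOne]
    split_ifs
    · ring
    · rfl
  leibniz_lie x y z := by
    funext k
    rcases k with ⟨k, hk⟩
    simp only [M0.add_apply, M0.bracket_apply, bracketOne]
    rcases k with _ | _ | _ | k <;> simp [-ZMod.neg_eq_self_mod_two]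
    ring

instance (n : ℕ) : LieRing (M2 n) where
  add_lie x y z := by
    funext k
    simp only [M2.add_apply, M2.bracket_apply, bracketOne, bracketTwo]
    split_ifs <;> ring
  lie_add x y z := by
    funext k
    simp only [M2.add_apply, M2.bracket_apply, bracketOne, bracketTwo]
    split_ifs <;> ring
  lie_self x := by
    funext k
    change _ = (0 : ZMod 2)
    simp only [M2.bracket_apply, bracketOne, bracketTwo]
    split_ifs <;> ring
  leibniz_lie x y z := by
    funext k
    rcases k with ⟨k, hk⟩
    simp only [M2.add_apply, M2.bracket_apply, bracketOne, bracketTwo]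
    rcases k with _ | _ | _ | _ | _ | _ | _ | k <;> simp [-ZMod.neg_eq_self_mod_two] <;> ring

instance (n : ℕ) : LieAlgebra (ZMod 2) (M0 n) where
  lie_smul c x y := by
    funext k
    simp only [M0.smul_apply, M0.bracket_apply, bracketOne]
    split_ifs <;> ring

instance (n : ℕ) : LieAlgebra (ZMod 2) (M2 n) where
  lie_smul c x y := by
    funext k
    simp only [M2.smul_apply, M2.bracket_apply, bracketOne, bracketTwo]
    split_ifs <;> ring

/-- `[e₁, e_i] = e_{i+1}` in `𝔪₀(n)`. -/
theorem M0.lie_basis_one {n : ℕ} (i j k : Fin n)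
    (hi : i.val = 0) (hj : 1 ≤ j.val) (hk : k.val = j.val + 1) :
    ⁅M0.basis n i, M0.basis n j⁆ = M0.basis n k := by
  funext l
  simp only [M0.bracket_apply, bracketOne, M0.basis_apply, Fin.ext_iff]
  split_ifs <;> first | omega | simp

/-- `[e₁, e_i] = e_{i+1}` in `𝔪₂(n)`. -/
theorem M2.lie_basis_one {n : ℕ} (i j k : Fin n)
    (hi : i.val = 0) (hj : 1 ≤ j.val) (hk : k.val = j.val + 1) :
    ⁅M2.basis n i, M2.basis n j⁆ = M2.basis n k := by
  funext l
  simp only [M2.bracket_apply, bracketOne, bracketTwo, M2.basis_apply,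
    Fin.ext_iff]
  split_ifs <;> first | omega | simp

/-- `[e₂, e_j] = e_{j+2}` in `𝔪₂(n)`. -/
theorem M2.lie_basis_two {n : ℕ} (i j k : Fin n)
    (hi : i.val = 1) (hj : 2 ≤ j.val) (hk : k.val = j.val + 2) :
    ⁅M2.basis n i, M2.basis n j⁆ = M2.basis n k := by
  funext l
  simp only [M2.bracket_apply, bracketOne, bracketTwo, M2.basis_apply,
    Fin.ext_iff]
  split_ifs <;> first | omega | simp

/-! ## Derivations of an exterior algebra over `𝔽₂` -/

/-- In characteristic two the exterior algebra is commutative. -/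
theorem ExteriorAlgebra.mul_comm_zmod_two {V : Type*} [AddCommGroup V] [Module (ZMod 2) V]
    (x y : ExteriorAlgebra (ZMod 2) V) : x * y = y * x := by
  have key : ∀ u v : V, ExteriorAlgebra.ι (ZMod 2) u * ExteriorAlgebra.ι (ZMod 2) v =
      ExteriorAlgebra.ι (ZMod 2) v * ExteriorAlgebra.ι (ZMod 2) u := fun u v => by
    rw [eq_neg_of_add_eq_zero_left (ExteriorAlgebra.ι_add_mul_swap u v), ← neg_one_smul (ZMod 2),
      show (-1 : ZMod 2) = 1 from rfl, one_smul]
  induction x using ExteriorAlgebra.induction with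
  | algebraMap r => exact Algebra.commutes r y
  | ι u =>
    induction y using ExteriorAlgebra.induction with
    | algebraMap r => exact (Algebra.commutes r _).symm
    | ι v => exact key u v
    | mul a b ha hb => rw [← mul_assoc, ha, mul_assoc, hb, mul_assoc]
    | add a b ha hb => rw [mul_add, add_mul, ha, hb]
  | mul a b ha hb => rw [mul_assoc, hb, ← mul_assoc, ha, mul_assoc]
  | add a b ha hb => rw [mul_add, add_mul, ha, hb]

section Derivation

variable {V : Type*} [AddCommGroup V] [Module (ZMod 2) V]

/-- The algebra map `ω ↦ ω + ε dω` whose second component is the derivation extending `δ`. -/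
noncomputable def extDerivationHom (δ : V →ₗ[ZMod 2] ExteriorAlgebra (ZMod 2) V) :
    ExteriorAlgebra (ZMod 2) V →ₐ[ZMod 2]
      TrivSqZeroExt (ExteriorAlgebra (ZMod 2) V) (ExteriorAlgebra (ZMod 2) V) :=
  ExteriorAlgebra.lift (ZMod 2)
    ⟨TrivSqZeroExt.inlAlgHom (ZMod 2) (ExteriorAlgebra (ZMod 2) V)
        (ExteriorAlgebra (ZMod 2) V) ∘ₗ ExteriorAlgebra.ι (ZMod 2) +
      (TrivSqZeroExt.inrHom (ExteriorAlgebra (ZMod 2) V)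
        (ExteriorAlgebra (ZMod 2) V)).restrictScalars (ZMod 2) ∘ₗ δ, fun v => by
      ext
      · simp
      · simp [ExteriorAlgebra.mul_comm_zmod_two (δ v), ← two_smul (ZMod 2),
          show (2 : ZMod 2) = 0 from rfl]⟩

/-- The unique extension of a linear map `δ : V → Λ(V)` to a derivation of `Λ(V)`. -/
noncomputable def extDerivation (δ : V →ₗ[ZMod 2] ExteriorAlgebra (ZMod 2) V) :
    ExteriorAlgebra (ZMod 2) V →ₗ[ZMod 2] ExteriorAlgebra (ZMod 2) V :=
  (TrivSqZeroExt.sndHom (ExteriorAlgebra (ZMod 2) V)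
    (ExteriorAlgebra (ZMod 2) V)).restrictScalars (ZMod 2) ∘ₗ (extDerivationHom δ).toLinearMap

theorem extDerivation_ι (δ : V →ₗ[ZMod 2] ExteriorAlgebra (ZMod 2) V) (v : V) :
    extDerivation δ (ExteriorAlgebra.ι (ZMod 2) v) = δ v := by
  simp [extDerivation, extDerivationHom]

theorem fst_extDerivationHom (δ : V →ₗ[ZMod 2] ExteriorAlgebra (ZMod 2) V)
    (x : ExteriorAlgebra (ZMod 2) V) : (extDerivationHom δ x).fst = x := by
  have h : (TrivSqZeroExt.fstHom (ZMod 2) (ExteriorAlgebra (ZMod 2) V)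
      (ExteriorAlgebra (ZMod 2) V)).comp (extDerivationHom δ) = AlgHom.id (ZMod 2) _ := by
    ext v
    simp [extDerivationHom]
  exact DFunLike.congr_fun h x

/-- The Leibniz rule. -/
theorem extDerivation_mul (δ : V →ₗ[ZMod 2] ExteriorAlgebra (ZMod 2) V)
    (x y : ExteriorAlgebra (ZMod 2) V) :
    extDerivation δ (x * y) = extDerivation δ x * y + x * extDerivation δ y := by
  simp [extDerivation, fst_extDerivationHom, add_comm]

end Derivation

/-! ## Cohomology with trivial coefficients of a Lie algebra over `𝔽₂` -/

section Cohomology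

variable {ι L : Type*} [Fintype ι] [LinearOrder ι] [LieRing L] [LieAlgebra (ZMod 2) L]

open Module

/-- The differential on one-forms, `dξ(X, Y) = ξ[X, Y]`, written in a basis `(e_i)` of `L` with dual
basis `(e^i)`: `dξ = ∑_{i < j} ξ[e_i, e_j] e^i ∧ e^j`. -/
noncomputable def ceOne (b : Basis ι (ZMod 2) L) :
    Dual (ZMod 2) L →ₗ[ZMod 2] ExteriorAlgebra (ZMod 2) (Dual (ZMod 2) L) where
  toFun ξ := ∑ i, ∑ j, if i < j then
    ξ ⁅b i, b j⁆ • (ExteriorAlgebra.ι (ZMod 2) (b.coord i) * ExteriorAlgebra.ι (ZMod 2) (b.coord j))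
    else 0
  map_add' ξ η := by
    simp only [← Finset.sum_add_distrib]
    refine Finset.sum_congr rfl fun i _ => Finset.sum_congr rfl fun j _ => ?_
    split_ifs
    · simp [add_smul]
    · simp
  map_smul' c ξ := by
    simp only [Finset.smul_sum]
    refine Finset.sum_congr rfl fun i _ => Finset.sum_congr rfl fun j _ => ?_
    split_ifs
    · simp [mul_smul]
    · simp

theorem ceOne_eq (b : Basis ι (ZMod 2) L) (ξ : Dual (ZMod 2) L) : ceOne b ξ =
   ((∑ i, ∑ j, if i < j then ξ ⁅b i, b j⁆ • exteriorPower.ιMulti (ZMod 2) 2 ![b.coord i, b.coord j] else 0 :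
    ⋀[ZMod 2]^2 (Dual (ZMod 2) L)) : ExteriorAlgebra (ZMod 2) (Dual (ZMod 2) L)) := by
  simp only [ceOne, LinearMap.coe_mk, AddHom.coe_mk, Submodule.coe_sum]
  refine Finset.sum_congr rfl fun i _ => Finset.sum_congr rfl fun j _ => ?_
  split_ifs <;> simp [ExteriorAlgebra.ιMulti_apply]

/-- The two-form `dξ` is characterized, independently of the basis, by `dξ(X, Y) = ξ[X, Y]`. -/
theorem ceOne_pairing (b : Basis ι (ZMod 2) L) (ξ : Dual (ZMod 2) L) : ∃ ω : ⋀[ZMod 2]^2 (Dual (ZMod 2) L), ceOne b ξ = ω ∧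
   ∀ X Y : L, exteriorPower.pairingDual (ZMod 2) L 2 ω (exteriorPower.ιMulti (ZMod 2) 2 ![X, Y]) = ξ ⁅X, Y⁆ := by
  refine ⟨_, ceOne_eq b ξ, fun X Y => ?_⟩
  have key : ∀ i j, exteriorPower.pairingDual (ZMod 2) L 2 (if i < j then ξ ⁅b i, b j⁆ • exteriorPower.ιMulti (ZMod 2) 2 ![b.coord i, b.coord j] else 0) (exteriorPower.ιMulti (ZMod 2) 2 ![X, Y])
     = if i < j then ξ ⁅b i, b j⁆ * (b.coord i X * b.coord j Y - b.coord j X * b.coord i Y) else 0 := by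
    intro i j
    split_ifs
    · simp [exteriorPower.pairingDual_ιMulti_ιMulti, Matrix.det_fin_two]
    · simp
  simp only [map_sum, LinearMap.sum_apply, key]
  have hB : ∀ X Y : L, ξ ⁅X, Y⁆ = ∑ i, ∑ j, b.coord i X * b.coord j Y * ξ ⁅b i, b j⁆ := by
    intro X Y
    conv_lhs => rw [← b.sum_repr X, ← b.sum_repr Y]
    simp only [sum_lie, lie_sum, smul_lie, lie_smul, map_sum, map_smul, smul_eq_mul, Basis.coord_apply, Finset.mul_sum]
    first
    | exact Finset.sum_congr rfl fun i _ => Finset.sum_congr rfl fun j _ => by ring1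
    | rw [Finset.sum_comm]; exact Finset.sum_congr rfl fun i _ => Finset.sum_congr rfl fun j _ => by ring1
  have hsw : ∀ i j, ξ ⁅b j, b i⁆ = - ξ ⁅b i, b j⁆ := fun i j => by rw [← lie_skew, map_neg]
  have h1 : ∀ i j, b.coord i X * b.coord j Y * ξ ⁅b i, b j⁆ =
      (if i < j then b.coord i X * b.coord j Y * ξ ⁅b i, b j⁆ else 0) +
      (if j < i then b.coord i X * b.coord j Y * ξ ⁅b i, b j⁆ else 0) := fun i j => by
    rcases lt_trichotomy i j with h | rfl | h
    · simp [h, h.not_gt]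
    · simp
    · simp [h, h.not_gt]
  rw [hB, Finset.sum_congr rfl fun i _ => Finset.sum_congr rfl fun j _ => h1 i j]
  simp_rw [Finset.sum_add_distrib]
  rw [Finset.sum_comm (f := fun i j => if j < i then _ else _)]
  simp_rw [← Finset.sum_add_distrib]
  refine Finset.sum_congr rfl fun i _ => Finset.sum_congr rfl fun j _ => ?_
  split_ifs
  · rw [hsw i j]; ring
  · simp

/-- The differential `d` of `Λ(L^*)`: the derivation that extends `ceOne`. -/
noncomputable def ceD (b : Basis ι (ZMod 2) L) :
    ExteriorAlgebra (ZMod 2) (Dual (ZMod 2) L) →ₗ[ZMod 2]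
      ExteriorAlgebra (ZMod 2) (Dual (ZMod 2) L) :=
  extDerivation (ceOne b)

/-- The `q`-cocycles `ker (d : Λ^q → Λ^{q+1})`. -/
noncomputable def cocycles (b : Basis ι (ZMod 2) L) (q : ℕ) :
    Submodule (ZMod 2) (ExteriorAlgebra (ZMod 2) (Dual (ZMod 2) L)) :=
  (⋀[ZMod 2]^q (Dual (ZMod 2) L)) ⊓ LinearMap.ker (ceD b)

/-- The `q`-coboundaries `im (d : Λ^{q-1} → Λ^q)`, which is zero for `q = 0`. -/
noncomputable def coboundaries (b : Basis ι (ZMod 2) L) :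
    ℕ → Submodule (ZMod 2) (ExteriorAlgebra (ZMod 2) (Dual (ZMod 2) L))
  | 0 => ⊥
  | q + 1 => (⋀[ZMod 2]^q (Dual (ZMod 2) L)).map (ceD b)

/-- The cohomology `H^q(L)` with trivial coefficients `𝔽₂`. -/
abbrev LieCohomology (b : Basis ι (ZMod 2) L) (q : ℕ) : Type _ :=
  cocycles b q ⧸ (coboundaries b q).submoduleOf (cocycles b q)

/-- The Betti number `b_q(L) = dim H^q(L)`. -/
noncomputable def bettiNumber (b : Basis ι (ZMod 2) L) (q : ℕ) : ℕ :=
  finrank (ZMod 2) (LieCohomology b q)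

end Cohomology

/-! Let `D` be the derivation of the exterior algebra with `e^{k+1} ↦ e^k` for `k ≥ 2` and `e^1, e^2
↦ 0`. The differential of `𝔪₀` is `e^1 ∧ D`. Squares of derivations are derivations in
characteristic two, and the differential of `𝔪₂` is `e^1 ∧ D + e^2 ∧ D²`. If `J` is the derivation
with `e^1 ↦ e^2` and all other `e^k ↦ 0`, the involution `1 + D J` conjugates one differential into
the other (`twist_modelZero`), so the Betti numbers agree and only `𝔪₀` has to be computed.

On the span of `e^2, …, e^{N+1}` the map inducing `D` is multiplication by `t` on `𝔽₂[t]/(t^N)`, and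
`e^1 ∧ ·` is injective on the exterior algebra of that span. Hence `b_{q+1}(𝔪₀(N+1)) = f_q(N) +
f_{q+1}(N)` (`complexBetti_modelZero`), where `f_q(N)` is the dimension of the cokernel of `D` in
degree `q`, or dually of the alternating `q`-forms killed by `D` (`invariantForms`). One has `f_0 =
f_1 = 1` for `N ≥ 1`, and `f_2 = ⌊N/2⌋`, with basis the forms `(u, v) ↦ coeff_{2i+1}(u v)`.

For `f_3`, write `N + 1 = 2^p + r`. Modulo forms for `N`, a form for `N + 1` is given by its values
`F(N, a, b)` on monomials. These depend only on `a + b`, vanish for `a + b` even, and are determined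
by the first `r` odd values. For the last point, the three shifts have sum zero, so each satisfies
`x³ = σ₂ x + σ₃`. With `h_n` the coefficient of `x²` in `x^n`, it suffices that `σ₂^r h_N` lies in
the ideal `(h_{N+1}, h_{N+2}, h_{N+3})` (`pow_mul_cubicSeq`), which rests on `h_{2^p - 1} = 0`. So
`f_3(N+1) ≤ f_3(N) + r`. Conversely `D^{2^p} = 0` for `N = 2^p` gives `f_3(2^p) ≥ C(2^p, 3) / 2^p`,
which is exactly the sum of the increments; every inequality in between is therefore an equality. -/

/-! ## Derivations of the exterior algebra -/

section ExteriorDerivations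

variable {V V' : Type*} [AddCommGroup V] [Module (ZMod 2) V] [AddCommGroup V'] [Module (ZMod 2) V']

/-- Linear maps satisfying the Leibniz rule along an algebra map are determined on generators. -/
theorem leibniz_ext (φ : ExteriorAlgebra (ZMod 2) V →ₐ[ZMod 2] ExteriorAlgebra (ZMod 2) V')
    {f g : ExteriorAlgebra (ZMod 2) V →ₗ[ZMod 2] ExteriorAlgebra (ZMod 2) V'}
    (hf : ∀ x y, f (x * y) = f x * φ y + φ x * f y)
    (hg : ∀ x y, g (x * y) = g x * φ y + φ x * g y)
    (h : ∀ v, f (ExteriorAlgebra.ι (ZMod 2) v) = g (ExteriorAlgebra.ι (ZMod 2) v)) : f = g := by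
  have h1 : ∀ k : ExteriorAlgebra (ZMod 2) V →ₗ[ZMod 2] ExteriorAlgebra (ZMod 2) V',
      (∀ x y, k (x * y) = k x * φ y + φ x * k y) → k 1 = 0 := fun k hk => by
    simpa using hk 1 1
  refine LinearMap.ext fun x => ?_
  induction x using ExteriorAlgebra.induction with
  | algebraMap r => simp only [Algebra.algebraMap_eq_smul_one, map_smul, h1 f hf, h1 g hg]
  | ι v => exact h v
  | mul a b ha hb => rw [hf, hg, ha, hb]
  | add a b ha hb => rw [map_add, map_add, ha, hb]

theorem leibniz_eq_zero {f : ExteriorAlgebra (ZMod 2) V →ₗ[ZMod 2] ExteriorAlgebra (ZMod 2) V}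
    (hf : ∀ x y, f (x * y) = f x * y + x * f y)
    (h : ∀ v, f (ExteriorAlgebra.ι (ZMod 2) v) = 0) (x : ExteriorAlgebra (ZMod 2) V) : f x = 0 := by
  have : f = 0 := leibniz_ext (AlgHom.id (ZMod 2) _) (by simpa using hf) (by simp) (by simpa using h)
  simp [this]

theorem extDerivation_one (δ : V →ₗ[ZMod 2] ExteriorAlgebra (ZMod 2) V) :
    extDerivation δ 1 = 0 := by
  simpa using extDerivation_mul δ 1 1

theorem extDerivation_map (f : V →ₗ[ZMod 2] V') {δ : V →ₗ[ZMod 2] ExteriorAlgebra (ZMod 2) V}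
    {δ' : V' →ₗ[ZMod 2] ExteriorAlgebra (ZMod 2) V'}
    (h : ∀ v, δ' (f v) = ExteriorAlgebra.map f (δ v)) (x : ExteriorAlgebra (ZMod 2) V) :
    extDerivation δ' (ExteriorAlgebra.map f x) = ExteriorAlgebra.map f (extDerivation δ x) := by
  have := leibniz_ext (ExteriorAlgebra.map f)
    (f := extDerivation δ' ∘ₗ (ExteriorAlgebra.map f).toLinearMap)
    (g := (ExteriorAlgebra.map f).toLinearMap ∘ₗ extDerivation δ)
    (fun x y => by simp [extDerivation_mul]) (fun x y => by simp [extDerivation_mul])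
    (fun v => by simp [extDerivation_ι, h])
  exact LinearMap.congr_fun this x

theorem ι_mem_exteriorPower (v : V) : ExteriorAlgebra.ι (ZMod 2) v ∈ ⋀[ZMod 2]^1 V := by
  rw [ExteriorAlgebra.exteriorPower, pow_one]
  exact LinearMap.mem_range_self _ v

theorem mul_mem_exteriorPower {i j : ℕ} {x y : ExteriorAlgebra (ZMod 2) V}
    (hx : x ∈ ⋀[ZMod 2]^i V) (hy : y ∈ ⋀[ZMod 2]^j V) : x * y ∈ ⋀[ZMod 2]^(i + j) V := by
  rw [ExteriorAlgebra.exteriorPower, pow_add]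
  exact Submodule.mul_mem_mul hx hy

/-- A derivation that raises the degree of one-forms by `k` raises all degrees by `k`. -/
theorem extDerivation_mem {k : ℕ} {δ : V →ₗ[ZMod 2] ExteriorAlgebra (ZMod 2) V}
    (h : ∀ v, δ v ∈ ⋀[ZMod 2]^(1 + k) V) {q : ℕ} {x : ExteriorAlgebra (ZMod 2) V}
    (hx : x ∈ ⋀[ZMod 2]^q V) : extDerivation δ x ∈ ⋀[ZMod 2]^(q + k) V := by
  induction q generalizing x with
  | zero =>
    rw [ExteriorAlgebra.exteriorPower, pow_zero, Submodule.mem_one] at hx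
    obtain ⟨r, rfl⟩ := hx
    rw [Algebra.algebraMap_eq_smul_one, map_smul, extDerivation_one, smul_zero]
    exact Submodule.zero_mem _
  | succ q ih =>
    rw [ExteriorAlgebra.exteriorPower, pow_succ'] at hx
    induction hx using Submodule.mul_induction_on' with
    | mem_mul_mem a ha b hb =>
      obtain ⟨v, rfl⟩ := ha
      rw [extDerivation_mul, extDerivation_ι]
      refine Submodule.add_mem _ ?_ ?_
      · rw [show q + 1 + k = 1 + k + q by ring]
        exact mul_mem_exteriorPower (h v) hb
      · rw [show q + 1 + k = 1 + (q + k) by ring]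
        exact mul_mem_exteriorPower (ι_mem_exteriorPower v) (ih hb)
    | add a _ b _ ha hb => rw [map_add]; exact Submodule.add_mem _ ha hb

theorem map_mem_exteriorPower (f : V →ₗ[ZMod 2] V') {q : ℕ} {x : ExteriorAlgebra (ZMod 2) V}
    (hx : x ∈ ⋀[ZMod 2]^q V) : ExteriorAlgebra.map f x ∈ ⋀[ZMod 2]^q V' := by
  have h : (⋀[ZMod 2]^q V).map (ExteriorAlgebra.map f).toLinearMap ≤ ⋀[ZMod 2]^q V' := by
    rw [Submodule.map_pow, ExteriorAlgebra.ι_range_map_map]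
    exact pow_le_pow_left' (by rintro _ ⟨v, -, rfl⟩; exact LinearMap.mem_range_self _ _) q
  exact h ⟨x, hx, rfl⟩

/-- The degree-preserving derivation of the exterior algebra induced by an endomorphism. -/
noncomputable def inducedDerivation (S : V →ₗ[ZMod 2] V) :
    ExteriorAlgebra (ZMod 2) V →ₗ[ZMod 2] ExteriorAlgebra (ZMod 2) V :=
  extDerivation (ExteriorAlgebra.ι (ZMod 2) ∘ₗ S)

theorem inducedDerivation_ι (S : V →ₗ[ZMod 2] V) (v : V) :
    inducedDerivation S (ExteriorAlgebra.ι (ZMod 2) v) = ExteriorAlgebra.ι (ZMod 2) (S v) := by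
  simp [inducedDerivation, extDerivation_ι]

theorem inducedDerivation_mul (S : V →ₗ[ZMod 2] V) (x y : ExteriorAlgebra (ZMod 2) V) :
    inducedDerivation S (x * y) = inducedDerivation S x * y + x * inducedDerivation S y :=
  extDerivation_mul _ x y

theorem inducedDerivation_mem (S : V →ₗ[ZMod 2] V) {q : ℕ} {x : ExteriorAlgebra (ZMod 2) V}
    (hx : x ∈ ⋀[ZMod 2]^q V) : inducedDerivation S x ∈ ⋀[ZMod 2]^q V :=
  extDerivation_mem (k := 0) (fun v => ι_mem_exteriorPower (S v)) hx

theorem inducedDerivation_map (f : V →ₗ[ZMod 2] V') {S : V →ₗ[ZMod 2] V} {S' : V' →ₗ[ZMod 2] V'}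
    (h : ∀ v, S' (f v) = f (S v)) (x : ExteriorAlgebra (ZMod 2) V) :
    inducedDerivation S' (ExteriorAlgebra.map f x) =
      ExteriorAlgebra.map f (inducedDerivation S x) :=
  extDerivation_map f (fun v => by simp [h]) x

/-- In characteristic two the square of a derivation is a derivation. -/
theorem inducedDerivation_sq (S : V →ₗ[ZMod 2] V) (x : ExteriorAlgebra (ZMod 2) V) :
    inducedDerivation S (inducedDerivation S x) = inducedDerivation (S ∘ₗ S) x := by
  have := leibniz_ext (AlgHom.id (ZMod 2) _)
    (f := inducedDerivation S ∘ₗ inducedDerivation S) (g := inducedDerivation (S ∘ₗ S))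
    (fun x y => by
      simp only [LinearMap.comp_apply, inducedDerivation_mul, map_add, AlgHom.id_apply]
      -- The mixed term `D x * D y` occurs twice and cancels.
      rw [show ∀ a b c d : ExteriorAlgebra (ZMod 2) V, a + b + (c + d) = a + d + (b + c) from
        fun a b c d => by abel, show ∀ a : ExteriorAlgebra (ZMod 2) V, a + a = 0 from
        ZModModule.add_self, add_zero])
    (fun x y => by simp [inducedDerivation_mul])
    (fun v => by simp [inducedDerivation_ι])
  exact LinearMap.congr_fun this x

theorem inducedDerivation_zero (x : ExteriorAlgebra (ZMod 2) V) :
    inducedDerivation (0 : V →ₗ[ZMod 2] V) x = 0 :=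
  leibniz_eq_zero (inducedDerivation_mul 0) (fun v => by simp [inducedDerivation_ι]) x

theorem inducedDerivation_pow_two_pow (S : Module.End (ZMod 2) V) (p : ℕ) :
    (inducedDerivation S : Module.End (ZMod 2) _) ^ 2 ^ p = inducedDerivation (S ^ 2 ^ p) := by
  induction p with
  | zero => simp
  | succ p ih =>
    rw [pow_succ 2, pow_mul, pow_mul, ih]
    refine LinearMap.ext fun x => ?_
    rw [pow_two, pow_two, Module.End.mul_apply, inducedDerivation_sq]
    rfl

theorem inducedDerivation_comm {S T : V →ₗ[ZMod 2] V} (h : ∀ v, S (T v) = T (S v))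
    (x : ExteriorAlgebra (ZMod 2) V) :
    inducedDerivation S (inducedDerivation T x) = inducedDerivation T (inducedDerivation S x) := by
  rw [← sub_eq_zero]
  refine leibniz_eq_zero (f := inducedDerivation S ∘ₗ inducedDerivation T -
    inducedDerivation T ∘ₗ inducedDerivation S) (fun x y => ?_) (fun v => ?_) x
  · simp only [LinearMap.sub_apply, LinearMap.comp_apply, inducedDerivation_mul, map_add]
    noncomm_ring
  · simp [inducedDerivation_ι, h]

/-- The Leibniz rule for a product of one-forms. -/
theorem inducedDerivation_ιMulti (S : V →ₗ[ZMod 2] V) {q : ℕ} (v : Fin q → V) :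
    inducedDerivation S (ExteriorAlgebra.ιMulti (ZMod 2) q v) =
      ∑ i, ExteriorAlgebra.ιMulti (ZMod 2) q (Function.update v i (S (v i))) := by
  induction q with
  | zero => simpa [inducedDerivation] using extDerivation_one _
  | succ q ih =>
    rw [ExteriorAlgebra.ιMulti_succ_apply, inducedDerivation_mul, inducedDerivation_ι, ih,
      Fin.sum_univ_succ, Finset.mul_sum]
    congr 1
    · rw [ExteriorAlgebra.ιMulti_succ_apply]
      simp [Matrix.vecTail, Function.comp_def]
    · refine Finset.sum_congr rfl fun i _ => ?_
      rw [ExteriorAlgebra.ιMulti_succ_apply]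
      congr 2
      ext j
      simp only [Matrix.vecTail, Function.comp_apply]
      rcases eq_or_ne j i with rfl | h
      · simp
      · rw [Function.update_of_ne h, Function.update_of_ne (by simpa using h)]
        rfl

end ExteriorDerivations

/-! ## Cohomology of graded complexes on exterior algebras -/

section ComplexBetti

open Module

variable {V V' : Type*} [AddCommGroup V] [Module (ZMod 2) V] [AddCommGroup V'] [Module (ZMod 2) V']

/-- The dimension of `ker d / im d` in degree `q + 1`. -/
noncomputable def complexBetti
    (d : ExteriorAlgebra (ZMod 2) V →ₗ[ZMod 2] ExteriorAlgebra (ZMod 2) V) (q : ℕ) : ℕ :=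
  finrank (ZMod 2) (↥((⋀[ZMod 2]^(q + 1) V) ⊓ LinearMap.ker d) ⧸
    ((⋀[ZMod 2]^q V).map d).submoduleOf ((⋀[ZMod 2]^(q + 1) V) ⊓ LinearMap.ker d))

theorem complexBetti_congr {d : ExteriorAlgebra (ZMod 2) V →ₗ[ZMod 2] ExteriorAlgebra (ZMod 2) V}
    {d' : ExteriorAlgebra (ZMod 2) V' →ₗ[ZMod 2] ExteriorAlgebra (ZMod 2) V'}
    (Φ : ExteriorAlgebra (ZMod 2) V ≃ₗ[ZMod 2] ExteriorAlgebra (ZMod 2) V')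
    (hΦ : ∀ q x, x ∈ ⋀[ZMod 2]^q V → Φ x ∈ ⋀[ZMod 2]^q V')
    (hΦ' : ∀ q x, x ∈ ⋀[ZMod 2]^q V' → Φ.symm x ∈ ⋀[ZMod 2]^q V)
    (hd : ∀ x, Φ (d x) = d' (Φ x)) (q : ℕ) : complexBetti d q = complexBetti d' q := by
  have hd' : ∀ x, Φ.symm (d' x) = d (Φ.symm x) := fun x => by
    rw [LinearEquiv.symm_apply_eq, hd, LinearEquiv.apply_symm_apply]
  have hcoc : ((⋀[ZMod 2]^(q + 1) V) ⊓ LinearMap.ker d).map (Φ : _ →ₗ[ZMod 2] _) =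
      (⋀[ZMod 2]^(q + 1) V') ⊓ LinearMap.ker d' := by
    ext y
    constructor
    · rintro ⟨x, ⟨hx, hx'⟩, rfl⟩
      refine ⟨hΦ _ _ hx, ?_⟩
      have hx0 : d x = 0 := hx'
      simp [← hd, hx0]
    · rintro ⟨hy, hy'⟩
      have hy0 : d' y = 0 := hy'
      exact ⟨Φ.symm y, ⟨hΦ' _ _ hy, by simp [← hd', hy0]⟩, by simp⟩
  refine LinearEquiv.finrank_eq (Submodule.Quotient.equiv _ _ (Φ.ofSubmodules _ _ hcoc) ?_)
  ext ⟨y, hy⟩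
  simp only [Submodule.mem_map, Submodule.submoduleOf, Submodule.mem_comap, Submodule.subtype_apply]
  constructor
  · rintro ⟨⟨x, hx⟩, ⟨z, hz, hzx⟩, hxy⟩
    refine ⟨Φ z, hΦ _ _ hz, ?_⟩
    rw [← hd, hzx]
    exact congrArg Subtype.val hxy
  · rintro ⟨z, hz, hzy⟩
    have hy2 : Φ.symm y ∈ (⋀[ZMod 2]^(q + 1) V) ⊓ LinearMap.ker d := by
      rw [← hcoc] at hy
      obtain ⟨x, hx, rfl⟩ := hy
      simpa using hx
    refine ⟨⟨Φ.symm y, hy2⟩, ⟨Φ.symm z, hΦ' _ _ hz, ?_⟩, ?_⟩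
    · rw [← hd', hzy]
    · exact Subtype.ext (Φ.apply_symm_apply y)

/-- If the cochain spaces are finite-dimensional, Betti numbers are determined by ranks. -/
theorem complexBetti_add_finrank [Module.Finite (ZMod 2) V]
    {d : ExteriorAlgebra (ZMod 2) V →ₗ[ZMod 2] ExteriorAlgebra (ZMod 2) V}
    (hd : ∀ q x, x ∈ ⋀[ZMod 2]^q V → d x ∈ ⋀[ZMod 2]^(q + 1) V) (hdd : ∀ x, d (d x) = 0) (q : ℕ) :
    complexBetti d q + finrank (ZMod 2) ((⋀[ZMod 2]^q V).map d) +
      finrank (ZMod 2) ((⋀[ZMod 2]^(q + 1) V).map d) = (finrank (ZMod 2) V).choose (q + 1) := by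
  set Z := (⋀[ZMod 2]^(q + 1) V) ⊓ LinearMap.ker d with hZ
  have hle : (⋀[ZMod 2]^q V).map d ≤ Z := by
    rintro _ ⟨x, hx, rfl⟩
    exact ⟨hd _ _ hx, hdd x⟩
  have : Module.Finite (ZMod 2) Z :=
    Submodule.finiteDimensional_of_le (S₂ := ⋀[ZMod 2]^(q + 1) V) inf_le_left
  have h1 := Submodule.finrank_quotient_add_finrank (((⋀[ZMod 2]^q V).map d).submoduleOf Z)
  rw [(Submodule.submoduleOfEquivOfLe hle).finrank_eq] at h1
  have h2 := LinearMap.finrank_range_add_finrank_ker (d.domRestrict (⋀[ZMod 2]^(q + 1) V))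
  rw [exteriorPower.finrank_eq, LinearMap.range_domRestrict] at h2
  have h3 : finrank (ZMod 2) (LinearMap.ker (d.domRestrict (⋀[ZMod 2]^(q + 1) V))) =
      finrank (ZMod 2) Z := by
    rw [LinearMap.ker_domRestrict, hZ, ← Submodule.map_comap_subtype]
    exact (LinearEquiv.finrank_eq (Submodule.equivMapOfInjective _
      (Submodule.injective_subtype _) _))
  change finrank (ZMod 2) (↥Z ⧸ ((⋀[ZMod 2]^q V).map d).submoduleOf Z) + _ + _ = _
  omega

end ComplexBetti

/-! ## A linear recurrence -/

section Recurrence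

variable {R : Type*} [CommRing R]

/-- The sequence `h₀ = h₁ = 0`, `h₂ = 1`, `h_{n+3} = a h_{n+1} + b h_n`. In `R[x]/(x³ - a x - b)` the
coefficient of `x²` in `xⁿ` is `hₙ`. -/
def cubicSeq (a b : R) : ℕ → R
  | 0 => 0
  | 1 => 0
  | 2 => 1
  | n + 3 => a * cubicSeq a b (n + 1) + b * cubicSeq a b n

theorem cubicSeq_add_three (a b : R) (n : ℕ) :
    cubicSeq a b (n + 3) = a * cubicSeq a b (n + 1) + b * cubicSeq a b n := by
  rw [cubicSeq]

/-- Frobenius relations in characteristic two. -/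
theorem cubicSeq_frobenius (h2 : (2 : R) = 0) (a b : R) (n : ℕ) :
    cubicSeq a b (2 * n + 1) = b * cubicSeq a b n ^ 2 ∧
      cubicSeq a b (2 * n + 2) = cubicSeq a b (n + 2) ^ 2 + a * cubicSeq a b (n + 1) ^ 2 ∧
      cubicSeq a b (2 * n + 3) = b * cubicSeq a b (n + 1) ^ 2 := by
  -- The relations can be read off by squaring `x^n = h_n x² + h_{n+1} x + v` in `R[x]/(x³ - a x -
  -- b)`. The third clause is the first one at `n + 1`, carried along because the recurrence reaches
  -- back three steps.
  induction n with
  | zero => simp [cubicSeq]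
  | succ n ih =>
    obtain ⟨i1, i2, i3⟩ := ih
    have e4 := cubicSeq_add_three a b (2 * n + 1)
    have e5 := cubicSeq_add_three a b (2 * n + 2)
    have e3 := cubicSeq_add_three a b n
    refine ⟨i3, ?_, ?_⟩
    · rw [show 2 * (n + 1) + 2 = 2 * n + 1 + 3 by ring, show n + 1 + 2 = n + 3 by ring, e4, e3,
        show 2 * n + 1 + 1 = 2 * n + 2 by ring, i1, i2, show n + 1 + 1 = n + 2 by ring]
      linear_combination (-a * b * cubicSeq a b (n + 1) * cubicSeq a b n) * h2
    · rw [show 2 * (n + 1) + 3 = 2 * n + 2 + 3 by ring, e5,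
        show 2 * n + 2 + 1 = 2 * n + 3 by ring, i2, i3, show n + 1 + 1 = n + 2 by ring]
      linear_combination (a * b * cubicSeq a b (n + 1) ^ 2) * h2

/-- Since `2^{p+1} - 1 = 2 (2^p - 1) + 1`, the relation `h_{2n+1} = b h_n²` propagates `h_0 = 0`. -/
theorem cubicSeq_two_pow_sub_one (h2 : (2 : R) = 0) (a b : R) (p : ℕ) :
    cubicSeq a b (2 ^ p - 1) = 0 := by
  induction p with
  | zero => simp [cubicSeq]
  | succ p ih =>
    have : 2 ^ (p + 1) - 1 = 2 * (2 ^ p - 1) + 1 := by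
      have := Nat.one_le_two_pow (n := p)
      rw [pow_succ]
      omega
    rw [this, (cubicSeq_frobenius h2 a b _).1, ih]
    ring

/-- As functions of `r`, both sides satisfy the recurrence with initial values `0, h_{k+1},
h_{k+2}`. -/
theorem cubicSeq_add (a b : R) {k : ℕ} (hk : cubicSeq a b k = 0) (r : ℕ) :
    cubicSeq a b (k + r) =
      cubicSeq a b (r + 1) * cubicSeq a b (k + 1) + cubicSeq a b r * cubicSeq a b (k + 2) := by
  induction r using Nat.strong_induction_on with
  | _ r ih =>
    match r with
    | 0 => simp [cubicSeq, hk]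
    | 1 => simp [cubicSeq]
    | 2 => simp [cubicSeq]
    | r + 3 =>
      rw [← add_assoc, cubicSeq_add_three a b (k + r), add_assoc k r 1, ih (r + 1) (by omega),
        ih r (by omega), cubicSeq_add_three a b r, show r + 3 + 1 = r + 1 + 3 by ring,
        cubicSeq_add_three a b (r + 1)]
      ring

/-- Modulo `b` the recurrence is `h_{n+3} = a h_{n+1}`, so the two parities separate. -/
theorem cubicSeq_mod (a b : R) (n : ℕ) :
    (∃ c, cubicSeq a b (2 * n + 2) = a ^ n + b * c) ∧ ∃ c, cubicSeq a b (2 * n + 1) = b * c := by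
  induction n with
  | zero => exact ⟨⟨0, by simp [cubicSeq]⟩, ⟨0, by simp [cubicSeq]⟩⟩
  | succ n ih =>
    obtain ⟨⟨c, hc⟩, ⟨c', hc'⟩⟩ := ih
    refine ⟨⟨a * c + cubicSeq a b (2 * n + 1), ?_⟩, ⟨a * c' + cubicSeq a b (2 * n), ?_⟩⟩
    · rw [show 2 * (n + 1) + 2 = 2 * n + 1 + 3 by ring, cubicSeq_add_three,
        show 2 * n + 1 + 1 = 2 * n + 2 by ring, hc]
      ring
    · rw [show 2 * (n + 1) + 1 = 2 * n + 3 by ring, cubicSeq_add_three, hc']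
      ring

/-- Up to sign, a power of `a` is a minor of the recurrence, modulo `b`. -/
theorem exists_minor_cubicSeq (a b : R) (r : ℕ) :
    ∃ ε c : R, a ^ r = ε * (cubicSeq a b (r + 2) ^ 2 -
      cubicSeq a b (r + 1) * cubicSeq a b (r + 3)) + b * c := by
  obtain ⟨s, rfl | rfl⟩ := Nat.even_or_odd' r
  · obtain ⟨⟨c, hc⟩, ⟨c', hc'⟩⟩ := cubicSeq_mod a b s
    refine ⟨1, -(2 * a ^ s * c + b * c ^ 2) + c' * cubicSeq a b (2 * s + 3), ?_⟩
    rw [hc, hc']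
    ring
  · obtain ⟨⟨c, hc⟩, -⟩ := cubicSeq_mod a b s
    obtain ⟨⟨c₂, hc₂⟩, ⟨c', hc'⟩⟩ := cubicSeq_mod a b (s + 1)
    refine ⟨-1, b * c' ^ 2 - a ^ s * c₂ - c * a ^ (s + 1) - b * c * c₂, ?_⟩
    rw [show 2 * s + 1 + 2 = 2 * (s + 1) + 1 by ring, show 2 * s + 1 + 1 = 2 * s + 2 by ring,
      show 2 * s + 1 + 3 = 2 * (s + 1) + 2 by ring, hc, hc₂, hc']
    ring

/-- With `k = 2^p - 1`, `cubicSeq_add` writes `h_N, h_{N+1}, h_{N+2}` as combinations of `h_{k+1}`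
and `h_{k+2}`. The determinant for the last two is the minor of `exists_minor_cubicSeq`, so Cramer's
rule expresses minor times `h_N` through `h_{N+1}` and `h_{N+2}`. The error modulo `b` is absorbed
by `b h_N = h_{N+3} - a h_{N+1}`. -/
theorem pow_mul_cubicSeq (h2 : (2 : R) = 0) (a b : R) {p r N : ℕ} (hN : N + 1 = 2 ^ p + r) :
    ∃ A B C : R, a ^ r * cubicSeq a b N =
      A * cubicSeq a b (N + 1) + B * cubicSeq a b (N + 2) + C * cubicSeq a b (N + 3) := by
  have hk := cubicSeq_add a b (cubicSeq_two_pow_sub_one h2 a b p)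
  obtain ⟨k, hkp⟩ : ∃ k, 2 ^ p - 1 = k := ⟨_, rfl⟩
  have hNk : N = k + r := by
    have := Nat.one_le_two_pow (n := p)
    omega
  rw [hkp] at hk
  obtain ⟨ε, c, h⟩ := exists_minor_cubicSeq a b r
  have h3 := cubicSeq_add_three a b N
  have e1 := hk (r + 1)
  have e2 := hk (r + 2)
  have e0 := hk r
  rw [← add_assoc, ← hNk, add_assoc r 1 1] at e1
  rw [← add_assoc, ← hNk, add_assoc r 2 1] at e2
  rw [← hNk] at e0
  simp only [Nat.reduceAdd] at e1 e2
  set x := cubicSeq a b (k + 1)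
  set y := cubicSeq a b (k + 2)
  set g0 := cubicSeq a b r
  set g1 := cubicSeq a b (r + 1)
  set g2 := cubicSeq a b (r + 2)
  set g3 := cubicSeq a b (r + 3)
  refine ⟨ε * (g1 * g2 - g0 * g3) - c * a, ε * (g0 * g2 - g1 ^ 2), c, ?_⟩
  rw [h, h3, e1, e2, e0]
  ring

end Recurrence

/-! ## Alternating functions of three indices killed by the shift derivation -/

section ShiftInvariant

/-- The alternating functions `F` on `ℕ³` supported on indices `< M`, with
`F(i+1, j, k) + F(i, j+1, k) + F(i, j, k+1) = 0`. -/
def shiftInvariant (M : ℕ) : Submodule (ZMod 2) (ℕ → ℕ → ℕ → ZMod 2) where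
  carrier := {F | (∀ i j k, F i j k = F j i k) ∧ (∀ i j k, F i j k = F i k j) ∧
    (∀ i k, F i i k = 0) ∧ (∀ i j k, M ≤ i → F i j k = 0) ∧
    ∀ i j k, F (i + 1) j k + F i (j + 1) k + F i j (k + 1) = 0}
  add_mem' := by
    rintro F G ⟨a1, a2, a3, a4, a5⟩ ⟨b1, b2, b3, b4, b5⟩
    refine ⟨fun i j k => ?_, fun i j k => ?_, fun i k => ?_, fun i j k h => ?_, fun i j k => ?_⟩ <;>
      simp only [Pi.add_apply]
    · rw [a1, b1]
    · rw [a2, b2]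
    · rw [a3, b3, add_zero]
    · rw [a4 i j k h, b4 i j k h, add_zero]
    · linear_combination a5 i j k + b5 i j k
  zero_mem' := by simp
  smul_mem' := by
    rintro c F ⟨a1, a2, a3, a4, a5⟩
    refine ⟨fun i j k => ?_, fun i j k => ?_, fun i k => ?_, fun i j k h => ?_, fun i j k => ?_⟩ <;>
      simp only [Pi.smul_apply, smul_eq_mul]
    · rw [a1]
    · rw [a2]
    · rw [a3, mul_zero]
    · rw [a4 i j k h, mul_zero]
    · linear_combination c * a5 i j k

variable {M : ℕ}

/-- The action of the second elementary symmetric function of the shifts. -/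
def shiftTwo (M : ℕ) : Module.End (ZMod 2) (shiftInvariant M) where
  toFun F := ⟨fun i j k => F.1 (i + 1) (j + 1) k + F.1 (i + 1) j (k + 1) + F.1 i (j + 1) (k + 1), by
    obtain ⟨F, a1, a2, a3, a4, a5⟩ := F
    refine ⟨fun i j k => ?_, fun i j k => ?_, fun i k => ?_, fun i j k h => ?_, fun i j k => ?_⟩ <;>
      dsimp only
    · rw [a1 (i + 1) (j + 1), a1 (i + 1) j, a1 i (j + 1)]
      ring
    · rw [a2 (i + 1) (j + 1), a2 (i + 1) j, a2 i (j + 1)]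
      ring
    · rw [a3, a1 i (i + 1), zero_add, CharTwo.add_self_eq_zero]
    · have h' : M ≤ i + 1 := h.trans (Nat.le_succ i)
      rw [a4 _ _ _ h', a4 _ _ _ h', a4 _ _ _ h]
      simp
    · linear_combination a5 (i + 1) (j + 1) k + a5 (i + 1) j (k + 1) + a5 i (j + 1) (k + 1)⟩
  map_add' F G := by
    ext i j k
    simp only [Submodule.coe_add, Pi.add_apply]
    ring
  map_smul' c F := by
    ext i j k
    simp only [Submodule.coe_smul, Pi.smul_apply, smul_eq_mul, RingHom.id_apply]
    ring

/-- The action of the third elementary symmetric function of the shifts. -/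
def shiftThree (M : ℕ) : Module.End (ZMod 2) (shiftInvariant M) where
  toFun F := ⟨fun i j k => F.1 (i + 1) (j + 1) (k + 1), by
    obtain ⟨F, a1, a2, a3, a4, a5⟩ := F
    exact ⟨fun _ _ _ => a1 _ _ _, fun _ _ _ => a2 _ _ _, fun _ _ => a3 _ _,
      fun i j k h => a4 _ _ _ (h.trans (Nat.le_succ i)), fun _ _ _ => a5 _ _ _⟩⟩
  map_add' F G := rfl
  map_smul' c F := rfl

theorem shiftTwo_apply (F : shiftInvariant M) (i j k : ℕ) : (shiftTwo M F).1 i j k =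
    F.1 (i + 1) (j + 1) k + F.1 (i + 1) j (k + 1) + F.1 i (j + 1) (k + 1) := rfl

theorem shiftThree_apply (F : shiftInvariant M) (i j k : ℕ) :
    (shiftThree M F).1 i j k = F.1 (i + 1) (j + 1) (k + 1) := rfl

/-- The relation `x³ = σ₂ x + σ₃` for the shift of the first index, evaluated at `(a, 1, 0)`. -/
theorem shiftInvariant_apply_add_three (F : shiftInvariant M) (a : ℕ) :
    F.1 (a + 3) 1 0 = (shiftTwo M F).1 (a + 1) 1 0 + (shiftThree M F).1 a 1 0 := by
  have h := F.2.2.2.2.2 (a + 2) 1 0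
  have h2 := F.2.2.2.2.2 (a + 1) 1 0
  rw [shiftTwo_apply, shiftThree_apply]
  have e1 : (2 : ZMod 2) = 0 := rfl
  linear_combination h - (F.1 (a + 2) 2 0 + F.1 (a + 2) 1 1 + F.1 (a + 1) 2 1) * e1

/-- Of `x^n`, reduced to degree at most two, only the `x²` part survives, because `F(1, 1, 0)` and
`F(0, 1, 0)` vanish by alternation. The recurrence runs in a commutative ring `S`, as the
endomorphism ring is not known to be commutative. -/
theorem shiftInvariant_apply_one_zero {S : Type*} [CommRing S]
    (φ : S →+* Module.End (ZMod 2) (shiftInvariant M)) {a b : S} (ha : φ a = shiftTwo M)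
    (hb : φ b = shiftThree M) (n : ℕ) (F : shiftInvariant M) :
    F.1 n 1 0 = (φ (cubicSeq a b n) F).1 2 1 0 := by
  induction n using Nat.strong_induction_on generalizing F with
  | _ n ih =>
    match n with
    | 0 =>
      rw [F.2.2.1 0 1 0, F.2.1 0 0 1 |>.symm |>.trans (F.2.2.2.1 0 1)]
      simp [cubicSeq]
    | 1 => simpa [cubicSeq] using F.2.2.2.1 1 0
    | 2 => simp [cubicSeq]
    | n + 3 =>
      rw [shiftInvariant_apply_add_three, ih (n + 1) (by omega), ih n (by omega), ← ha, ← hb,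
        cubicSeq_add_three, mul_comm a, mul_comm b, map_add, map_mul, map_mul]
      rfl

/-- The value at `(2, 1, 0)` of `h_n G` is `G(n, 1, 0)`, which is zero for every `G` once `n > N`.
So the three terms of `pow_mul_cubicSeq` contribute nothing. -/
theorem map_pow_apply_eq_zero {p r N : ℕ} (hN : N + 1 = 2 ^ p + r) {S : Type*} [CommRing S]
    (h2 : (2 : S) = 0) (φ : S →+* Module.End (ZMod 2) (shiftInvariant (N + 1))) {a b : S}
    (ha : φ a = shiftTwo (N + 1)) (hb : φ b = shiftThree (N + 1)) (F : shiftInvariant (N + 1)) :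
    (φ (a ^ r) F).1 N 1 0 = 0 := by
  obtain ⟨A, B, C, h⟩ := pow_mul_cubicSeq h2 a b hN
  have key := shiftInvariant_apply_one_zero φ ha hb
  rw [key, ← Module.End.mul_apply, ← map_mul, mul_comm, h,
    mul_comm A, mul_comm B, mul_comm C, map_add, map_add, map_mul, map_mul, map_mul]
  simp only [LinearMap.add_apply, Module.End.mul_apply, Submodule.coe_add, Pi.add_apply, ← key]
  rw [(φ A F).2.2.2.2.1 _ _ _ le_rfl, (φ B F).2.2.2.2.1 _ _ _ (by omega),
    (φ C F).2.2.2.2.1 _ _ _ (by omega)]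
  simp

open scoped IsMulCommutative in
theorem shiftTwo_pow_apply_eq_zero {p r N : ℕ} (hN : N + 1 = 2 ^ p + r)
    (F : shiftInvariant (N + 1)) : ((shiftTwo (N + 1) ^ r) F).1 N 1 0 = 0 := by
  let s : Set (Module.End (ZMod 2) (shiftInvariant (N + 1))) :=
    {shiftTwo (N + 1), shiftThree (N + 1)}
  have hcomm : ∀ x ∈ s, ∀ y ∈ s, x * y = y * x := by
    rintro x (rfl | rfl) y (rfl | rfl) <;> rfl
  have := Algebra.isMulCommutative_adjoin (ZMod 2) hcomm
  have h2 : (2 : Algebra.adjoin (ZMod 2) s) = 0 :=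
    one_add_one_eq_two.symm.trans (ZModModule.add_self _)
  let a : Algebra.adjoin (ZMod 2) s :=
    ⟨shiftTwo (N + 1), Algebra.subset_adjoin (Set.mem_insert _ _)⟩
  let b : Algebra.adjoin (ZMod 2) s :=
    ⟨shiftThree (N + 1), Algebra.subset_adjoin (Set.mem_insert_of_mem _ rfl)⟩
  exact map_pow_apply_eq_zero hN h2 (Subalgebra.val (Algebra.adjoin (ZMod 2) s)).toRingHom
    (a := a) (b := b) rfl rfl F

/-- On the top slice the two terms of `σ₂` that raise the first index are out of range. -/
theorem shiftTwo_pow_apply (N i a b : ℕ) (F : shiftInvariant (N + 1)) :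
    ((shiftTwo (N + 1) ^ i) F).1 N a b = F.1 N (a + i) (b + i) := by
  induction i generalizing a b with
  | zero => simp
  | succ i ih =>
    rw [pow_succ', Module.End.mul_apply, shiftTwo_apply,
      ((shiftTwo (N + 1) ^ i) F).2.2.2.2.1 _ _ _ le_rfl,
      ((shiftTwo (N + 1) ^ i) F).2.2.2.2.1 _ _ _ le_rfl, ih]
    simp [add_comm, add_left_comm]

/-- The top slice of a shift-invariant function on `[0, N]³`, `N + 1 = 2ᵖ + r`, depends on `r`
values. -/
theorem shiftInvariant_top_eq_zero {p r N : ℕ} (hN : N + 1 = 2 ^ p + r)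
    (F : shiftInvariant (N + 1)) (hF : ∀ i < r, F.1 N (2 * i + 1) 0 = 0) (a b : ℕ) :
    F.1 N a b = 0 := by
  have hstep : ∀ a b, F.1 N (a + 1) b = F.1 N a (b + 1) := fun a b => by
    have := F.2.2.2.2.2 N a b
    rw [F.2.2.2.2.1 _ _ _ le_rfl, zero_add] at this
    exact CharTwo.add_eq_zero.1 this
  have hshift : ∀ b a, F.1 N a b = F.1 N (a + b) 0 := fun b => by
    induction b with
    | zero => simp
    | succ b ih => intro a; rw [← hstep, ih]; rw [show a + 1 + b = a + (b + 1) by ring]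
  have hdiag : ∀ i, F.1 N i i = 0 := fun i => by
    rw [F.2.1, F.2.2.1, F.2.2.2.1]
  rw [hshift]
  obtain ⟨i, hi | hi⟩ := Nat.even_or_odd' (a + b)
  · rw [hi, two_mul, ← hshift, hdiag]
  · rw [hi]
    by_cases h : i < r
    · exact hF i h
    · obtain ⟨j, rfl⟩ := Nat.exists_eq_add_of_le (not_lt.1 h)
      -- Sliding indices to `(N, 1 + (r + j), r + j)` shows the value to be that of `σ₂^{r+j} F` at
      -- `(N, 1, 0)`.
      have h1 := shiftTwo_pow_apply_eq_zero hN ((shiftTwo (N + 1) ^ j) F)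
      rw [← Module.End.mul_apply, ← pow_add, shiftTwo_pow_apply, hshift] at h1
      rw [← h1, show 2 * (r + j) + 1 = 1 + (r + j) + (0 + (r + j)) by ring]

end ShiftInvariant

/-! ## Alternating forms on `𝔽₂[X]` killed by multiplication by `X` -/

section InvariantForms

open Module Polynomial

/-- The alternating `q`-forms on `𝔽₂[X]/(X^N)` killed by the derivation induced by multiplication
by `X`, viewed as forms on `𝔽₂[X]`. -/
def invariantForms (q N : ℕ) : Submodule (ZMod 2) ((ZMod 2)[X] [⋀^Fin q]→ₗ[ZMod 2] ZMod 2) where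
  carrier := {f | (∀ v i, X ^ N ∣ v i → f v = 0) ∧
    ∀ v, ∑ i, f (Function.update v i (X * v i)) = 0}
  add_mem' := by
    rintro f g ⟨a1, a2⟩ ⟨b1, b2⟩
    refine ⟨fun v i h => ?_, fun v => ?_⟩
    · rw [AlternatingMap.add_apply, a1 v i h, b1 v i h, add_zero]
    · simp only [AlternatingMap.add_apply, Finset.sum_add_distrib, a2, b2, add_zero]
  zero_mem' := by simp
  smul_mem' := by
    rintro c f ⟨a1, a2⟩
    refine ⟨fun v i h => ?_, fun v => ?_⟩
    · rw [AlternatingMap.smul_apply, a1 v i h, smul_zero]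
    · simp only [AlternatingMap.smul_apply, ← Finset.smul_sum, a2, smul_zero]

variable {q N : ℕ}

/-- Invariant forms only depend on the arguments modulo `X^N`. -/
theorem invariantForms_congr {f : (ZMod 2)[X] [⋀^Fin q]→ₗ[ZMod 2] ZMod 2}
    (hf : f ∈ invariantForms q N) {v w : Fin q → (ZMod 2)[X]} (h : ∀ i, X ^ N ∣ w i - v i) :
    f v = f w := by
  have key : ∀ s : Finset (Fin q), f (s.piecewise w v) = f v := fun s => by
    induction s using Finset.induction_on with
    | empty => simp
    | insert i s hi ih =>
      rw [Finset.piecewise_insert, ← ih, ← sub_eq_zero]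
      have h1 : f (s.piecewise w v) = f (Function.update (s.piecewise w v) i (v i)) := by
        rw [show v i = s.piecewise w v i by simp [hi], Function.update_eq_self]
      rw [h1, ← AlternatingMap.map_update_sub]
      exact hf.1 _ i (by simpa using h i)
  rw [← key Finset.univ, Finset.piecewise_univ]

theorem eq_zero_of_monomials {f : (ZMod 2)[X] [⋀^Fin q]→ₗ[ZMod 2] ZMod 2}
    (h : ∀ a : Fin q → ℕ, f (fun i => X ^ a i) = 0) : f = 0 := by
  refine Basis.ext_alternating (Polynomial.basisMonomials (ZMod 2)) fun a _ => ?_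
  simpa [← Polynomial.X_pow_eq_monomial] using h a

theorem update_X_mul_pow (a : Fin q → ℕ) (i : Fin q) :
    Function.update (fun j => (X : (ZMod 2)[X]) ^ a j) i (X * X ^ a i) =
      fun j => X ^ Function.update a i (a i + 1) j := by
  ext1 j
  rcases eq_or_ne j i with rfl | h
  · simp [pow_succ']
  · simp [h]

theorem invariantForms_shift {f : (ZMod 2)[X] [⋀^Fin q]→ₗ[ZMod 2] ZMod 2}
    (hf : f ∈ invariantForms q N) (a : Fin q → ℕ) :
    ∑ i, f (fun j => X ^ Function.update a i (a i + 1) j) = 0 := by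
  simpa only [update_X_mul_pow] using hf.2 (fun j => X ^ a j)

theorem invariantForms_monomial_eq_zero {f : (ZMod 2)[X] [⋀^Fin q]→ₗ[ZMod 2] ZMod 2}
    (hf : f ∈ invariantForms q N) {a : Fin q → ℕ} {i : Fin q} (h : N ≤ a i) :
    f (fun j => X ^ a j) = 0 :=
  hf.1 _ i (pow_dvd_pow X h)

/-! ### Forms of degree zero and one -/

theorem finrank_invariantForms_zero (N : ℕ) : finrank (ZMod 2) (invariantForms 0 N) = 1 := by
  have : invariantForms 0 N = ⊤ := by
    rw [eq_top_iff]
    exact fun f _ => ⟨fun v i => i.elim0, fun v => by simp⟩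
  rw [this, finrank_top]
  exact (AlternatingMap.constLinearEquivOfIsEmpty (R' := ZMod 2)
    (M'' := (ZMod 2)[X]) (N'' := ZMod 2) (ι := Fin 0)).finrank_eq.symm.trans (finrank_self _)

theorem finrank_invariantForms_one {N : ℕ} (hN : 1 ≤ N) :
    finrank (ZMod 2) (invariantForms 1 N) = 1 := by
  let T : invariantForms 1 N →ₗ[ZMod 2] ZMod 2 :=
    { toFun := fun f => f.1 fun _ => 1
      map_add' := fun _ _ => rfl
      map_smul' := fun _ _ => rfl }
  have hT : Function.Bijective T := by
    refine ⟨LinearMap.ker_eq_bot.1 <| LinearMap.ker_eq_bot'.2 fun f hf => Subtype.ext (eq_zero_of_monomials fun a => ?_),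
      fun c => ?_⟩
    · obtain h | hk := (a 0).eq_zero_or_eq_succ_pred
      · rw [← show f.1 (fun _ => 1) = 0 from hf]
        congr 1
        ext1 i
        rw [Subsingleton.elim i 0, h, pow_zero]
      · have := invariantForms_shift f.2 (fun _ => (a 0).pred)
        rw [Fin.sum_univ_one] at this
        rw [← this]
        congr 1
        ext1 i
        rw [Subsingleton.elim i 0, Function.update_self, ← Nat.succ_eq_add_one, ← hk]
    · refine ⟨⟨c • AlternatingMap.ofSubsingleton (ZMod 2) (ZMod 2)[X] (ZMod 2) (0 : Fin 1)
        (Polynomial.lcoeff (ZMod 2) 0), Submodule.smul_mem _ _ ⟨fun v i hi => ?_, fun v => ?_⟩⟩, ?_⟩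
      · rw [Subsingleton.elim i 0, X_pow_dvd_iff] at hi
        simpa using hi 0 hN
      · simp
      · simp [T]
  exact (LinearEquiv.ofBijective T hT).finrank_eq.trans (finrank_self _)

/-! ### Forms of degree two. -/

/-- The alternating form `(u, v) ↦ coeff_{2i+1}(u v)`. -/
noncomputable def oddCoeffForm (i : ℕ) : (ZMod 2)[X] [⋀^Fin 2]→ₗ[ZMod 2] ZMod 2 where
  toMultilinearMap := (Polynomial.lcoeff (ZMod 2) (2 * i + 1)).compMultilinearMap
    (MultilinearMap.mkPiAlgebra (ZMod 2) (Fin 2) (ZMod 2)[X])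
  map_eq_zero_of_eq' v j k hv hjk := by
    have h01 : v 0 = v 1 := by
      fin_cases j <;> fin_cases k <;> simp_all
    -- A square over `𝔽₂` is a polynomial in `X²`, so its odd coefficients vanish.
    have hsq : ((v 1) * (v 1)).coeff (2 * i + 1) = 0 := by
      rw [← pow_two, ← ZMod.expand_card, Polynomial.coeff_expand (by norm_num), if_neg (by omega)]
    simpa [Fin.prod_univ_two, h01] using hsq

theorem oddCoeffForm_apply (i : ℕ) (v : Fin 2 → (ZMod 2)[X]) :
    oddCoeffForm i v = (v 0 * v 1).coeff (2 * i + 1) := by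
  change (∏ j, v j).coeff (2 * i + 1) = _
  rw [Fin.prod_univ_two]

theorem oddCoeffForm_mem {i : ℕ} (hi : 2 * i + 1 < N) : oddCoeffForm i ∈ invariantForms 2 N := by
  refine ⟨fun v j hj => ?_, fun v => ?_⟩
  · rw [oddCoeffForm_apply]
    have : X ^ N ∣ v 0 * v 1 := by
      fin_cases j
      · exact Dvd.dvd.mul_right hj _
      · exact Dvd.dvd.mul_left hj _
    exact X_pow_dvd_iff.1 this _ hi
  · rw [Fin.sum_univ_two, oddCoeffForm_apply, oddCoeffForm_apply]
    simp only [Function.update_self, ne_eq, one_ne_zero, zero_ne_one, not_false_eq_true,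
      Function.update_of_ne]
    rw [mul_left_comm, ← mul_assoc, CharTwo.add_self_eq_zero]

/-- Invariance lets exponents slide between the two arguments, so only their sum matters; an even
sum slides to equal arguments. -/
theorem invariantForms_two_monomial {f : (ZMod 2)[X] [⋀^Fin 2]→ₗ[ZMod 2] ZMod 2}
    (hf : f ∈ invariantForms 2 N) (h : ∀ i, 2 * i + 1 < N → f ![X ^ (2 * i + 1), 1] = 0) :
    f = 0 := by
  have hstep : ∀ a b, f ![X ^ (a + 1), X ^ b] = f ![X ^ a, X ^ (b + 1)] := fun a b => by
    have := invariantForms_shift hf ![a, b]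
    rw [Fin.sum_univ_two, CharTwo.add_eq_zero] at this
    convert this using 2 <;> ext1 l <;> fin_cases l <;> rfl
  have hshift : ∀ b a, f ![X ^ a, X ^ b] = f ![X ^ (a + b), 1] := fun b => by
    induction b with
    | zero => simp
    | succ b ih => intro a; rw [← hstep, ih, show a + 1 + b = a + (b + 1) by ring]
  refine eq_zero_of_monomials fun a => ?_
  have e : (fun j => (X : (ZMod 2)[X]) ^ a j) = ![X ^ a 0, X ^ a 1] := by
    ext1 l
    fin_cases l <;> rfl
  rw [e, hshift]
  obtain ⟨i, hi | hi⟩ := Nat.even_or_odd' (a 0 + a 1)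
  · rw [hi, two_mul, ← hshift]
    exact f.map_eq_zero_of_eq _ (i := 0) (j := 1) rfl (by decide)
  · rw [hi]
    by_cases hN : 2 * i + 1 < N
    · exact h i hN
    · exact hf.1 _ 0 (pow_dvd_pow X (not_lt.1 hN))

theorem finrank_invariantForms_two (N : ℕ) : finrank (ZMod 2) (invariantForms 2 N) = N / 2 := by
  let T : invariantForms 2 N →ₗ[ZMod 2] (Fin (N / 2) → ZMod 2) :=
    { toFun := fun f i => f.1 ![X ^ (2 * i.val + 1), 1]
      map_add' := fun _ _ => rfl
      map_smul' := fun _ _ => rfl }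
  have hT : Function.Bijective T := by
    refine ⟨LinearMap.ker_eq_bot.1 <| LinearMap.ker_eq_bot'.2 fun f hf =>
      Subtype.ext (invariantForms_two_monomial f.2 fun i hi => ?_), fun c => ?_⟩
    · exact congr_fun hf ⟨i, by omega⟩
    · refine ⟨∑ i, c i • ⟨oddCoeffForm i.val, oddCoeffForm_mem (N := N) (by omega)⟩, ?_⟩
      have hval : ∀ i j : Fin (N / 2),
          T ⟨oddCoeffForm i.val, oddCoeffForm_mem (N := N) (by omega)⟩ j = if j = i then 1 else 0 :=
        fun i j => by
          change oddCoeffForm i.val ![X ^ (2 * j.val + 1), 1] = _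
          rw [oddCoeffForm_apply]
          simp [coeff_X_pow, Fin.ext_iff, eq_comm]
      ext j
      rw [map_sum, Finset.sum_apply]
      simp only [map_smul, Pi.smul_apply, hval]
      simp
  exact (LinearEquiv.ofBijective T hT).finrank_eq.trans (by simp)

/-! ### The values on monomials -/

/-- The values of an invariant three-form on monomials. -/
noncomputable def monomialValues (f : invariantForms 3 N) : shiftInvariant N :=
  ⟨fun i j k => f.1 (fun l => X ^ (![i, j, k] : Fin 3 → ℕ) l), by
    obtain ⟨f, hf⟩ := f
    refine ⟨fun i j k => ?_, fun i j k => ?_, fun i k => ?_, fun i j k h => ?_, fun i j k => ?_⟩ <;>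
      dsimp only
    · have := f.map_swap (fun l => X ^ (![i, j, k] : Fin 3 → ℕ) l) (i := 0) (j := 1) (by decide)
      rw [ZMod.neg_eq_self_mod_two] at this
      rw [← this]
      congr 1
      ext1 l
      fin_cases l <;> rfl
    · have := f.map_swap (fun l => X ^ (![i, j, k] : Fin 3 → ℕ) l) (i := 1) (j := 2) (by decide)
      rw [ZMod.neg_eq_self_mod_two] at this
      rw [← this]
      congr 1
      ext1 l
      fin_cases l <;> rfl
    · exact f.map_eq_zero_of_eq _ (i := 0) (j := 1) rfl (by decide)
    · exact invariantForms_monomial_eq_zero hf (i := 0) h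
    · have := invariantForms_shift hf ![i, j, k]
      rw [Fin.sum_univ_three] at this
      convert this using 6 <;> rename_i l <;> fin_cases l <;> rfl⟩

theorem monomialValues_apply (f : invariantForms 3 N) (i j k : ℕ) :
    (monomialValues f).1 i j k = f.1 (fun l => X ^ (![i, j, k] : Fin 3 → ℕ) l) := rfl

/-- The values on the top slice that determine an invariant three-form up to forms on
`𝔽₂[X]/(X^N)`. -/
noncomputable def topValues (N r : ℕ) : invariantForms 3 (N + 1) →ₗ[ZMod 2] (Fin r → ZMod 2) where
  toFun f i := (monomialValues f).1 N (2 * i + 1) 0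
  map_add' _ _ := rfl
  map_smul' _ _ := rfl

theorem mem_of_top_eq_zero {f : (ZMod 2)[X] [⋀^Fin q]→ₗ[ZMod 2] ZMod 2}
    (hf : f ∈ invariantForms q (N + 1))
    (h : ∀ (a : Fin q → ℕ) (i : Fin q), a i = N → f (fun j => X ^ a j) = 0) :
    f ∈ invariantForms q N := by
  refine ⟨fun v i => ?_, hf.2⟩
  rintro ⟨u, hu⟩
  have key : ∀ m : MultilinearMap (ZMod 2) (fun _ : Fin q => (ZMod 2)[X]) (ZMod 2),
      (∀ a : Fin q → ℕ, m (fun j => X ^ a j) = 0) → m = 0 := fun m hm => by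
    refine Basis.ext_multilinear (fun _ => Polynomial.basisMonomials (ZMod 2)) fun a => ?_
    simpa [← Polynomial.X_pow_eq_monomial] using hm a
  -- Multiplying slot `i` by `X^N` reduces divisibility to monomials: the exponent there becomes
  -- `N`, covered by `h`, or exceeds `N`, where `f` vanishes anyway.
  let T : Fin q → ((ZMod 2)[X] →ₗ[ZMod 2] (ZMod 2)[X]) := fun j =>
    if j = i then LinearMap.mulLeft (ZMod 2) (X ^ N) else LinearMap.id
  have hT := key (f.toMultilinearMap.compLinearMap T) fun a => by
    rw [MultilinearMap.compLinearMap_apply]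
    have : (fun j => T j (X ^ a j)) = fun j => X ^ Function.update a i (N + a i) j := by
      ext1 j
      rcases eq_or_ne j i with rfl | hj
      · simp [T, pow_add]
      · simp [T, hj]
    rw [this]
    by_cases ha : a i = 0
    · exact h _ i (by simp [ha])
    · exact invariantForms_monomial_eq_zero hf (i := i) (by simp; omega)
  have := DFunLike.congr_fun hT (Function.update v i u)
  rw [MultilinearMap.compLinearMap_apply] at this
  rw [show v = fun j => T j (Function.update v i u j) from ?_]
  · exact this
  · ext1 j
    rcases eq_or_ne j i with rfl | hj
    · simp [T, hu]
    · simp [T, hj]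

/-- The whole top slice vanishes by `shiftInvariant_top_eq_zero`, and symmetry moves an exponent `N`
from any slot to the first. -/
theorem ker_topValues_le {p r : ℕ} (hN : N + 1 = 2 ^ p + r) :
    (LinearMap.ker (topValues N r)).map (invariantForms 3 (N + 1)).subtype ≤
      invariantForms 3 N := by
  rintro _ ⟨f, hf, rfl⟩
  have htop := shiftInvariant_top_eq_zero hN (monomialValues f)
    (fun i hi => congr_fun (LinearMap.mem_ker.1 hf) ⟨i, hi⟩)
  refine mem_of_top_eq_zero f.2 fun a i hi => ?_
  have hm := (monomialValues f).2
  have e : f.1 (fun j => X ^ a j) = (monomialValues f).1 (a 0) (a 1) (a 2) := by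
    rw [monomialValues_apply]
    congr 1
    ext1 l
    fin_cases l <;> rfl
  rw [Submodule.subtype_apply, e]
  fin_cases i
  · simp only [Fin.zero_eta, Fin.isValue] at hi
    rw [hi, htop]
  · simp only [Fin.mk_one, Fin.isValue] at hi
    rw [hm.1, hi, htop]
  · simp only [Fin.reduceFinMk, Fin.isValue] at hi
    rw [hm.2.1, hm.1, hi, htop]

theorem finrank_invariantForms_three_succ_le [Module.Finite (ZMod 2) (invariantForms 3 N)]
    [Module.Finite (ZMod 2) (invariantForms 3 (N + 1))] {p r : ℕ} (hN : N + 1 = 2 ^ p + r) :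
    finrank (ZMod 2) (invariantForms 3 (N + 1)) ≤ finrank (ZMod 2) (invariantForms 3 N) + r := by
  have h1 := LinearMap.finrank_range_add_finrank_ker (topValues N r)
  have h2 := Submodule.finrank_le (LinearMap.range (topValues N r))
  rw [finrank_fintype_fun_eq_card, Fintype.card_fin] at h2
  have h3 := Submodule.finrank_mono (ker_topValues_le hN)
  rw [Submodule.finrank_map_subtype_eq] at h3
  omega

/-- Base case of the upper bound: three exponents below `2` cannot be distinct. -/
theorem invariantForms_three_two : invariantForms 3 2 = ⊥ := by
  rw [eq_bot_iff]
  intro f hf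
  rw [Submodule.mem_bot]
  refine eq_zero_of_monomials fun a => ?_
  by_cases h : ∃ i, 2 ≤ a i
  · obtain ⟨i, hi⟩ := h
    exact invariantForms_monomial_eq_zero hf hi
  · push Not at h
    have : ¬ Function.Injective fun i : Fin 3 => (⟨a i, h i⟩ : Fin 2) := fun hi => by
      simpa using Fintype.card_le_of_injective _ hi
    rw [Function.not_injective_iff] at this
    obtain ⟨i, j, hij, hne⟩ := this
    rw [Fin.mk.injEq] at hij
    exact f.map_eq_zero_of_eq _ (by simp [hij]) hne

end InvariantForms

/-! ## Duality between invariant forms and the cokernel of the shift derivation -/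

section Duality

open Module Polynomial

/-- The shift `tⁱ ↦ tⁱ⁺¹` of `𝔽₂[t]/(t^N)`, in coordinates. -/
def truncShift (N : ℕ) : (Fin N → ZMod 2) →ₗ[ZMod 2] (Fin N → ZMod 2) where
  toFun v i := if 1 ≤ i.val then v ⟨i.val - 1, by omega⟩ else 0
  map_add' v w := by
    ext i
    by_cases h : 1 ≤ i.val <;> simp [h]
  map_smul' c v := by
    ext i
    by_cases h : 1 ≤ i.val <;> simp [h]

theorem truncShift_apply {N : ℕ} (v : Fin N → ZMod 2) (i : Fin N) :
    truncShift N v i = if 1 ≤ i.val then v ⟨i.val - 1, by omega⟩ else 0 := rfl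

theorem truncShift_pow_apply {N : ℕ} (k : ℕ) (v : Fin N → ZMod 2) (i : Fin N) :
    ((truncShift N : Module.End (ZMod 2) _) ^ k) v i =
      if k ≤ i.val then v ⟨i.val - k, by omega⟩ else 0 := by
  induction k generalizing v i with
  | zero => simp
  | succ k ih =>
    rw [pow_succ', Module.End.mul_apply, truncShift_apply]
    by_cases h : k + 1 ≤ i.val
    · rw [if_pos (by omega), if_pos h, ih, if_pos (by simp; omega)]
      congr 1
      ext
      simp
      omega
    · rw [if_neg h]
      split_ifs with h1
      · rw [ih, if_neg (by simp; omega)]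
      · rfl

/-- The coordinates of a polynomial modulo `X^N`. -/
noncomputable def truncCoeff (N : ℕ) : (ZMod 2)[X] →ₗ[ZMod 2] (Fin N → ZMod 2) :=
  LinearMap.pi fun i => Polynomial.lcoeff (ZMod 2) i

theorem truncCoeff_apply {N : ℕ} (p : (ZMod 2)[X]) (i : Fin N) :
    truncCoeff N p i = p.coeff i := rfl

/-- The polynomial of degree `< N` with given coordinates. -/
noncomputable def truncLift (N : ℕ) : (Fin N → ZMod 2) →ₗ[ZMod 2] (ZMod 2)[X] :=
  ∑ i : Fin N, Polynomial.monomial i.val ∘ₗ LinearMap.proj i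

theorem coeff_truncLift {N : ℕ} (v : Fin N → ZMod 2) (k : ℕ) :
    (truncLift N v).coeff k = if h : k < N then v ⟨k, h⟩ else 0 := by
  simp only [truncLift, LinearMap.sum_apply, LinearMap.comp_apply, LinearMap.proj_apply,
    Polynomial.finsetSum_coeff, Polynomial.coeff_monomial]
  split_ifs with h
  · rw [Finset.sum_eq_single ⟨k, h⟩]
    · simp
    · intro b _ hb
      exact if_neg fun hk => hb (Fin.ext hk)
    · simp
  · exact Finset.sum_eq_zero fun i _ => if_neg (by have := i.2; omega)

theorem truncCoeff_truncLift {N : ℕ} (v : Fin N → ZMod 2) : truncCoeff N (truncLift N v) = v := by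
  ext i
  rw [truncCoeff_apply, coeff_truncLift, dif_pos i.2]

theorem dvd_truncLift_truncCoeff {N : ℕ} (p : (ZMod 2)[X]) :
    X ^ N ∣ truncLift N (truncCoeff N p) - p := by
  rw [X_pow_dvd_iff]
  intro d hd
  rw [Polynomial.coeff_sub, coeff_truncLift, dif_pos hd, truncCoeff_apply, sub_self]

theorem truncCoeff_eq_zero {N : ℕ} {p : (ZMod 2)[X]} (h : X ^ N ∣ p) : truncCoeff N p = 0 := by
  ext i
  exact X_pow_dvd_iff.1 h i i.2

theorem truncShift_truncCoeff {N : ℕ} (p : (ZMod 2)[X]) :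
    truncShift N (truncCoeff N p) = truncCoeff N (X * p) := by
  ext ⟨i, hi⟩
  rw [truncShift_apply, truncCoeff_apply, mul_comm]
  rcases i with _ | i
  · simp [truncCoeff_apply]
  · simp [truncCoeff_apply]

theorem dvd_truncLift_truncShift {N : ℕ} (v : Fin N → ZMod 2) :
    X ^ N ∣ truncLift N (truncShift N v) - X * truncLift N v := by
  have := dvd_truncLift_truncCoeff (N := N) (X * truncLift N v)
  rwa [← truncShift_truncCoeff, truncCoeff_truncLift] at this

/-- The derivation of `Λ(𝔽₂[t]/(t^N))` induced by multiplication by `t`, in degree `q`. -/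
noncomputable def truncDerivation (q N : ℕ) :
    ⋀[ZMod 2]^q (Fin N → ZMod 2) →ₗ[ZMod 2] ⋀[ZMod 2]^q (Fin N → ZMod 2) :=
  (inducedDerivation (truncShift N)).restrict fun _ hx => inducedDerivation_mem _ hx

theorem truncDerivation_ιMulti {q N : ℕ} (v : Fin q → Fin N → ZMod 2) :
    truncDerivation q N (exteriorPower.ιMulti (ZMod 2) q v) =
      ∑ i, exteriorPower.ιMulti (ZMod 2) q (Function.update v i (truncShift N (v i))) := by
  ext1
  simpa [truncDerivation] using inducedDerivation_ιMulti (truncShift N) v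

/-- Linear functionals on `Λ^q(𝔽₂[t]/(t^N))` as alternating forms on `𝔽₂[X]`. -/
noncomputable def pullbackForm (q N : ℕ) : Dual (ZMod 2) (⋀[ZMod 2]^q (Fin N → ZMod 2)) →ₗ[ZMod 2]
    ((ZMod 2)[X] [⋀^Fin q]→ₗ[ZMod 2] ZMod 2) where
  toFun F := (exteriorPower.alternatingMapLinearEquiv.symm F).compLinearMap (truncCoeff N)
  map_add' F G := by
    ext v
    simp
  map_smul' c F := by
    ext v
    simp

theorem pullbackForm_apply {q N : ℕ} (F : Dual (ZMod 2) (⋀[ZMod 2]^q (Fin N → ZMod 2)))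
    (v : Fin q → (ZMod 2)[X]) :
    pullbackForm q N F v = F (exteriorPower.ιMulti (ZMod 2) q fun i => truncCoeff N (v i)) := by
  simp [pullbackForm]

theorem pullbackForm_injective (q N : ℕ) : Function.Injective (pullbackForm q N) := by
  refine LinearMap.ker_eq_bot.1 <| LinearMap.ker_eq_bot'.2 fun F hF => ?_
  refine exteriorPower.linearMap_ext ?_
  ext v
  have := DFunLike.congr_fun hF fun i => truncLift N (v i)
  rw [pullbackForm_apply] at this
  simpa [truncCoeff_truncLift] using this

/-- A functional kills the image of `D` exactly when its form is killed by the transposed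
derivation. `truncLift` commutes with multiplication by `X` only modulo `X^N`, which
`invariantForms_congr` absorbs. -/
theorem map_pullbackForm (q N : ℕ) :
    (LinearMap.range (truncDerivation q N)).dualAnnihilator.map (pullbackForm q N) =
      invariantForms q N := by
  ext f
  constructor
  · rintro ⟨F, hF, rfl⟩
    refine ⟨fun v i hv => ?_, fun v => ?_⟩
    · rw [pullbackForm_apply, AlternatingMap.map_coord_zero (i := i), map_zero]
      exact truncCoeff_eq_zero hv
    · have h := (Submodule.mem_dualAnnihilator F).1 hF _
        ⟨_, truncDerivation_ιMulti fun i => truncCoeff N (v i)⟩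
      rw [map_sum] at h
      rw [← h]
      refine Finset.sum_congr rfl fun i _ => ?_
      rw [pullbackForm_apply, truncShift_truncCoeff]
      congr 2
      ext1 j
      rcases eq_or_ne j i with rfl | hj
      · simp
      · simp [hj]
  · intro hf
    refine ⟨exteriorPower.alternatingMapLinearEquiv (f.compLinearMap (truncLift N)), ?_, ?_⟩
    · rw [SetLike.mem_coe, Submodule.mem_dualAnnihilator]
      rintro _ ⟨x, rfl⟩
      have : exteriorPower.alternatingMapLinearEquiv (f.compLinearMap (truncLift N)) ∘ₗ
          truncDerivation q N = 0 := by
        refine exteriorPower.linearMap_ext ?_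
        ext v
        simp only [LinearMap.compAlternatingMap_apply, LinearMap.comp_apply,
          truncDerivation_ιMulti, map_sum, exteriorPower.alternatingMapLinearEquiv_apply_ιMulti,
          AlternatingMap.compLinearMap_apply, LinearMap.zero_apply]
        rw [← hf.2 fun i => truncLift N (v i)]
        refine Finset.sum_congr rfl fun i _ => (invariantForms_congr hf fun j => ?_).symm
        rcases eq_or_ne j i with rfl | hj
        · simpa using dvd_truncLift_truncShift (v j)
        · simp [hj]
      exact LinearMap.congr_fun this x
    · ext v
      rw [pullbackForm_apply, exteriorPower.alternatingMapLinearEquiv_apply_ιMulti]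
      exact (invariantForms_congr hf fun i => dvd_truncLift_truncCoeff (v i)).symm

noncomputable def invariantFormsEquiv (q N : ℕ) :
    (LinearMap.range (truncDerivation q N)).dualAnnihilator ≃ₗ[ZMod 2] invariantForms q N :=
  (Submodule.equivMapOfInjective _ (pullbackForm_injective q N) _).trans
    (LinearEquiv.ofEq _ _ (map_pullbackForm q N))

instance invariantForms_finite (q N : ℕ) : Module.Finite (ZMod 2) (invariantForms q N) :=
  Module.Finite.equiv (invariantFormsEquiv q N)

theorem finrank_range_truncDerivation (q N : ℕ) :
    finrank (ZMod 2) (LinearMap.range (truncDerivation q N)) +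
      finrank (ZMod 2) (invariantForms q N) = N.choose q := by
  rw [← (invariantFormsEquiv q N).finrank_eq, Subspace.finrank_add_finrank_dualAnnihilator_eq,
    exteriorPower.finrank_eq, finrank_fin_fun]

theorem finrank_map_inducedDerivation (q N : ℕ) :
    finrank (ZMod 2) ((⋀[ZMod 2]^q (Fin N → ZMod 2)).map (inducedDerivation (truncShift N))) =
      finrank (ZMod 2) (LinearMap.range (truncDerivation q N)) := by
  have h : (⋀[ZMod 2]^q (Fin N → ZMod 2)).map (inducedDerivation (truncShift N)) =
      (LinearMap.range (truncDerivation q N)).map (Submodule.subtype _) := by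
    rw [← LinearMap.range_domRestrict, ← LinearMap.range_comp]
    rfl
  rw [h, Submodule.finrank_map_subtype_eq]

/-- `f` maps `ker f^{k+1}` into `ker f^k`, with kernel inside `ker f`. -/
theorem finrank_ker_pow_le {E : Type*} [AddCommGroup E] [Module (ZMod 2) E]
    [Module.Finite (ZMod 2) E] (f : Module.End (ZMod 2) E) (k : ℕ) :
    finrank (ZMod 2) (LinearMap.ker (f ^ k)) ≤ k * finrank (ZMod 2) (LinearMap.ker f) := by
  induction k with
  | zero => simp [Module.End.one_eq_id]
  | succ k ih =>
    have h1 := LinearMap.finrank_range_add_finrank_ker (f.domRestrict (LinearMap.ker (f ^ (k + 1))))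
    have h2 : LinearMap.range (f.domRestrict (LinearMap.ker (f ^ (k + 1)))) ≤
        LinearMap.ker (f ^ k) := by
      rintro _ ⟨⟨x, hx⟩, rfl⟩
      rw [LinearMap.mem_ker, pow_succ] at hx
      exact hx
    have h3 : finrank (ZMod 2) (LinearMap.ker (f.domRestrict (LinearMap.ker (f ^ (k + 1))))) ≤
        finrank (ZMod 2) (LinearMap.ker f) := by
      rw [LinearMap.ker_domRestrict, ← Submodule.finrank_map_subtype_eq]
      refine Submodule.finrank_mono ?_
      rintro _ ⟨x, hx, rfl⟩
      exact hx
    have h4 := Submodule.finrank_mono h2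
    rw [add_mul]
    omega

/-- For `N = 2ᵖ` the derivation satisfies `D^N = 0`, which bounds its kernel from below. -/
theorem choose_le_mul_finrank (q p : ℕ) :
    (2 ^ p).choose q ≤ 2 ^ p * finrank (ZMod 2) (invariantForms q (2 ^ p)) := by
  have h1 := LinearMap.finrank_range_add_finrank_ker (truncDerivation q (2 ^ p))
  have h2 := finrank_range_truncDerivation q (2 ^ p)
  rw [exteriorPower.finrank_eq, finrank_fin_fun] at h1
  have h3 := finrank_ker_pow_le (truncDerivation q (2 ^ p)) (2 ^ p)
  have h4 : truncDerivation q (2 ^ p) ^ 2 ^ p = 0 := by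
    rw [truncDerivation, Module.End.pow_restrict (2 ^ p)
      (fun _ hx => inducedDerivation_mem (truncShift (2 ^ p)) hx)]
    ext x
    have hS : (truncShift (2 ^ p) : Module.End (ZMod 2) _) ^ 2 ^ p = 0 := by
      refine LinearMap.ext fun v => funext fun i => ?_
      rw [truncShift_pow_apply, if_neg (by have := i.2; omega)]
      rfl
    simp only [inducedDerivation_pow_two_pow, hS]
    simp [inducedDerivation_zero]
  rw [h4, LinearMap.ker_zero, finrank_top, exteriorPower.finrank_eq, finrank_fin_fun] at h3
  -- Kernel and cokernel of an endomorphism have the same dimension.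
  rwa [show finrank (ZMod 2) (invariantForms q (2 ^ p)) =
    finrank (ZMod 2) (LinearMap.ker (truncDerivation q (2 ^ p))) by omega]

end Duality

/-! ## The dimension of the space of invariant three-forms -/

section ThreeForms

open Module

/-- The increments `1 + ⋯ + r` within a dyadic block give the quadratic term in `r`. -/
theorem finrank_invariantForms_three_upper (N : ℕ) : ∀ p r : ℕ, 1 ≤ p → N = 2 ^ p + r → r < 2 ^ p →
    6 * (finrank (ZMod 2) (invariantForms 3 N) : ℤ) ≤ (2 ^ p - 1) * (2 ^ p - 2) + 3 * r * (r + 1) := by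
  induction N with
  | zero =>
    intro p r _ h
    have := Nat.one_le_two_pow (n := p)
    omega
  | succ N ih =>
    intro p r hp hN hr
    have hle := finrank_invariantForms_three_succ_le hN
    zify at hle
    rcases r with _ | r
    · obtain rfl | ⟨p, rfl⟩ : p = 1 ∨ ∃ p', p = p' + 2 :=
        hp.eq_or_lt.imp Eq.symm fun h => ⟨p - 2, by omega⟩
      · obtain rfl : N = 1 := by omega
        rw [invariantForms_three_two]
        simp
      -- Entering a new block adds nothing, so the bound at the last element of the previous block
      -- must be the bound at the new power of two.
      · have h1 := Nat.one_le_two_pow (n := p + 1)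
        have h2 : 2 ^ (p + 2) = 2 * 2 ^ (p + 1) := pow_succ' 2 (p + 1)
        have := ih (p + 1) (2 ^ (p + 1) - 1) (by omega) (by omega) (by omega)
        push_cast [h1] at this hle
        rw [pow_succ' (2 : ℤ) (p + 1)]
        push_cast
        nlinarith
    · have := ih p r hp (by omega) (by omega)
      push_cast at this hle ⊢
      nlinarith

theorem finrank_invariantForms_three_two_pow (p : ℕ) : (2 ^ p - 1) * (2 ^ p - 2) ≤
    6 * (finrank (ZMod 2) (invariantForms 3 (2 ^ p)) : ℤ) := by
  have h := choose_le_mul_finrank 3 p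
  have h2 := Nat.descFactorial_eq_factorial_mul_choose (2 ^ p) 3
  have h1 := Nat.one_le_two_pow (n := p)
  rcases p with _ | p
  · simp
  have h3 : 2 ≤ 2 ^ (p + 1) := Nat.le_self_pow (by omega) 2
  simp only [Nat.descFactorial_succ, Nat.descFactorial_zero, Nat.factorial, Nat.sub_zero] at h2
  zify [h1, h3] at h h2
  have hQ : (0 : ℤ) < 2 ^ (p + 1) := by positivity
  refine le_of_mul_le_mul_left ?_ hQ
  push_cast at h2
  nlinarith

/-- Descent from `2^{p+1}`, where the lower bound is known, using that each step down loses at most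
the increment; `s` is the distance to the end of the block. -/
theorem finrank_invariantForms_three_lower {p : ℕ} (s : ℕ) : ∀ r : ℕ, r + s + 1 = 2 ^ p →
    (2 ^ p - 1) * (2 ^ p - 2) + 3 * r * (r + 1) ≤
      6 * (finrank (ZMod 2) (invariantForms 3 (2 ^ p + r)) : ℤ) := by
  induction s with
  | zero =>
    intro r hr
    have h1 := finrank_invariantForms_three_two_pow (p + 1)
    have h2 := finrank_invariantForms_three_succ_le (N := 2 ^ p + r) (p := p + 1) (r := 0)
      (by rw [pow_succ]; omega)
    rw [show 2 ^ p + r + 1 = 2 ^ (p + 1) by rw [pow_succ]; omega] at h2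
    zify at h2 hr
    rw [pow_succ] at h1
    nlinarith
  | succ s ih =>
    intro r hr
    have h1 := ih (r + 1) (by omega)
    have h2 := finrank_invariantForms_three_succ_le (N := 2 ^ p + r) (p := p) (r := r + 1) (by omega)
    rw [← add_assoc] at h1
    zify at h2
    push_cast at h1
    nlinarith

theorem finrank_invariantForms_three {p r : ℕ} (hp : 1 ≤ p) (hr : r < 2 ^ p) :
    6 * (finrank (ZMod 2) (invariantForms 3 (2 ^ p + r)) : ℤ) =
      (2 ^ p - 1) * (2 ^ p - 2) + 3 * r * (r + 1) :=
  le_antisymm (finrank_invariantForms_three_upper _ p r hp rfl hr)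
    (finrank_invariantForms_three_lower (2 ^ p - 1 - r) r (by omega))

end ThreeForms

/-! ## The complexes of `𝔪₀(n)` and `𝔪₂(n)` in coordinates -/

section Model

open Module

/-- The exterior generator with index `i`; it is zero if `i` is out of range. -/
noncomputable def extGen (n i : ℕ) : ExteriorAlgebra (ZMod 2) (Fin n → ZMod 2) :=
  ExteriorAlgebra.ι (ZMod 2) fun j => if j.val = i then 1 else 0

theorem extGen_mul_self (n i : ℕ) : extGen n i * extGen n i = 0 :=
  ExteriorAlgebra.ι_sq_zero _

theorem extGen_mem (n i : ℕ) : extGen n i ∈ ⋀[ZMod 2]^1 (Fin n → ZMod 2) :=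
  ι_mem_exteriorPower _

/-- The endomorphism `e^{k+1} ↦ e^k` for `k ≥ 2`, with `e^1, e^2 ↦ 0`. -/
def lowerIndex (n : ℕ) : (Fin n → ZMod 2) →ₗ[ZMod 2] (Fin n → ZMod 2) where
  toFun v i := if h : 1 ≤ i.val ∧ i.val + 1 < n then v ⟨i.val + 1, h.2⟩ else 0
  map_add' v w := by
    ext i
    by_cases h : 1 ≤ i.val ∧ i.val + 1 < n <;> simp [h]
  map_smul' c v := by
    ext i
    by_cases h : 1 ≤ i.val ∧ i.val + 1 < n <;> simp [h]

theorem lowerIndex_apply {n : ℕ} (v : Fin n → ZMod 2) (i : Fin n) :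
    lowerIndex n v i = if h : 1 ≤ i.val ∧ i.val + 1 < n then v ⟨i.val + 1, h.2⟩ else 0 := rfl

/-- The endomorphism `e^1 ↦ e^2`, with the other `e^k ↦ 0`. -/
def firstToSecond (n : ℕ) : (Fin n → ZMod 2) →ₗ[ZMod 2] (Fin n → ZMod 2) where
  toFun v i := if i.val = 1 then v ⟨0, i.pos⟩ else 0
  map_add' v w := by
    ext i
    by_cases h : i.val = 1 <;> simp [h]
  map_smul' c v := by
    ext i
    by_cases h : i.val = 1 <;> simp [h]

theorem firstToSecond_apply {n : ℕ} (v : Fin n → ZMod 2) (i : Fin n) :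
    firstToSecond n v i = if i.val = 1 then v ⟨0, i.pos⟩ else 0 := rfl

variable (n : ℕ)

/-- The differential of `𝔪₀(n)`. -/
noncomputable def modelZero : ExteriorAlgebra (ZMod 2) (Fin n → ZMod 2) →ₗ[ZMod 2]
    ExteriorAlgebra (ZMod 2) (Fin n → ZMod 2) :=
  LinearMap.mulLeft (ZMod 2) (extGen n 0) ∘ₗ inducedDerivation (lowerIndex n)

/-- The differential of `𝔪₂(n)`. -/
noncomputable def modelTwo : ExteriorAlgebra (ZMod 2) (Fin n → ZMod 2) →ₗ[ZMod 2]
    ExteriorAlgebra (ZMod 2) (Fin n → ZMod 2) :=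
  modelZero n + LinearMap.mulLeft (ZMod 2) (extGen n 1) ∘ₗ
    inducedDerivation (lowerIndex n) ∘ₗ inducedDerivation (lowerIndex n)

variable {n}

theorem modelZero_apply (x : ExteriorAlgebra (ZMod 2) (Fin n → ZMod 2)) :
    modelZero n x = extGen n 0 * inducedDerivation (lowerIndex n) x := rfl

theorem modelTwo_apply (x : ExteriorAlgebra (ZMod 2) (Fin n → ZMod 2)) :
    modelTwo n x = extGen n 0 * inducedDerivation (lowerIndex n) x + extGen n 1 *
      inducedDerivation (lowerIndex n) (inducedDerivation (lowerIndex n) x) := rfl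

theorem modelZero_mul (x y : ExteriorAlgebra (ZMod 2) (Fin n → ZMod 2)) :
    modelZero n (x * y) = modelZero n x * y + x * modelZero n y := by
  simp only [modelZero_apply, inducedDerivation_mul, mul_add, ← mul_assoc]
  rw [ExteriorAlgebra.mul_comm_zmod_two (extGen n 0) x]

theorem modelTwo_mul (x y : ExteriorAlgebra (ZMod 2) (Fin n → ZMod 2)) :
    modelTwo n (x * y) = modelTwo n x * y + x * modelTwo n y := by
  rw [modelTwo_apply, inducedDerivation_sq, inducedDerivation_mul, inducedDerivation_mul,
    ← inducedDerivation_sq, ← inducedDerivation_sq]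
  simp only [modelTwo_apply, mul_add, add_mul, ← mul_assoc]
  rw [ExteriorAlgebra.mul_comm_zmod_two (extGen n 0) x,
    ExteriorAlgebra.mul_comm_zmod_two (extGen n 1) x]
  abel

theorem inducedDerivation_lowerIndex_extGen {i : ℕ} (hi : i ≤ 1) :
    inducedDerivation (lowerIndex n) (extGen n i) = 0 := by
  rw [extGen, inducedDerivation_ι]
  rw [show lowerIndex n (fun j => if j.val = i then 1 else 0) = 0 from ?_, map_zero]
  ext j
  rw [lowerIndex_apply, Pi.zero_apply]
  split_ifs with h h'
  · dsimp only at h'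
    omega
  · rfl
  · rfl

theorem inducedDerivation_firstToSecond_extGen :
    inducedDerivation (firstToSecond n) (extGen n 0) = extGen n 1 := by
  rw [extGen, inducedDerivation_ι, extGen]
  congr 1

theorem modelZero_mem {q : ℕ} {x : ExteriorAlgebra (ZMod 2) (Fin n → ZMod 2)}
    (hx : x ∈ ⋀[ZMod 2]^q (Fin n → ZMod 2)) :
    modelZero n x ∈ ⋀[ZMod 2]^(q + 1) (Fin n → ZMod 2) := by
  rw [add_comm]
  exact mul_mem_exteriorPower (extGen_mem n 0) (inducedDerivation_mem _ hx)

theorem inducedDerivation_extGen_mul {i : ℕ} (hi : i ≤ 1)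
    (x : ExteriorAlgebra (ZMod 2) (Fin n → ZMod 2)) :
    inducedDerivation (lowerIndex n) (extGen n i * x) =
      extGen n i * inducedDerivation (lowerIndex n) x := by
  rw [inducedDerivation_mul, inducedDerivation_lowerIndex_extGen hi, zero_mul, zero_add]

theorem modelZero_modelZero (x : ExteriorAlgebra (ZMod 2) (Fin n → ZMod 2)) :
    modelZero n (modelZero n x) = 0 := by
  rw [modelZero_apply, modelZero_apply, inducedDerivation_extGen_mul (by omega), ← mul_assoc,
    extGen_mul_self, zero_mul]

/-- The automorphism `1 + D J` of the exterior algebra that intertwines the two differentials; `D`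
and `J` are the derivations induced by `lowerIndex` and `firstToSecond`. -/
noncomputable def twist (n : ℕ) : ExteriorAlgebra (ZMod 2) (Fin n → ZMod 2) →ₗ[ZMod 2]
    ExteriorAlgebra (ZMod 2) (Fin n → ZMod 2) :=
  LinearMap.id + inducedDerivation (lowerIndex n) ∘ₗ inducedDerivation (firstToSecond n)

theorem twist_apply (x : ExteriorAlgebra (ZMod 2) (Fin n → ZMod 2)) : twist n x =
    x + inducedDerivation (lowerIndex n) (inducedDerivation (firstToSecond n) x) := rfl

/-- On one-forms both composites are zero. -/
theorem lowerIndex_comm_firstToSecond (x : ExteriorAlgebra (ZMod 2) (Fin n → ZMod 2)) :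
    inducedDerivation (lowerIndex n) (inducedDerivation (firstToSecond n) x) =
      inducedDerivation (firstToSecond n) (inducedDerivation (lowerIndex n) x) := by
  refine inducedDerivation_comm (fun v => ?_) x
  ext i
  simp [lowerIndex_apply, firstToSecond_apply]
  omega

theorem firstToSecond_firstToSecond (x : ExteriorAlgebra (ZMod 2) (Fin n → ZMod 2)) :
    inducedDerivation (firstToSecond n) (inducedDerivation (firstToSecond n) x) = 0 := by
  rw [inducedDerivation_sq]
  have : firstToSecond n ∘ₗ firstToSecond n = 0 := by
    ext v i
    simp [firstToSecond_apply]
  rw [this, inducedDerivation_zero]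

/-- Every term of `J x` contains `e^2`. Formally, `x ↦ e^2 ∧ J x` is a derivation that vanishes on
one-forms. -/
theorem extGen_one_mul_firstToSecond (x : ExteriorAlgebra (ZMod 2) (Fin n → ZMod 2)) :
    extGen n 1 * inducedDerivation (firstToSecond n) x = 0 := by
  refine leibniz_eq_zero (f := LinearMap.mulLeft (ZMod 2) (extGen n 1) ∘ₗ
    inducedDerivation (firstToSecond n)) (fun x y => ?_) (fun v => ?_) x
  · simp only [LinearMap.comp_apply, LinearMap.mulLeft_apply, inducedDerivation_mul, mul_add,
      ← mul_assoc]
    rw [ExteriorAlgebra.mul_comm_zmod_two (extGen n 1) x]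
  · simp only [LinearMap.comp_apply, LinearMap.mulLeft_apply, inducedDerivation_ι, extGen]
    by_cases hn : 0 < n
    · rw [show firstToSecond n v = v ⟨0, hn⟩ • fun j : Fin n => if j.val = 1 then 1 else 0 from ?_,
        map_smul, mul_smul_comm, ExteriorAlgebra.ι_sq_zero, smul_zero]
      ext j
      simp [firstToSecond_apply]
    · rw [show firstToSecond n v = 0 from funext fun j => absurd j.pos hn]
      simp

theorem twist_twist (x : ExteriorAlgebra (ZMod 2) (Fin n → ZMod 2)) :
    twist n (twist n x) = x := by
  simp only [twist_apply, map_add]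
  rw [← lowerIndex_comm_firstToSecond (inducedDerivation (firstToSecond n) x),
    firstToSecond_firstToSecond, map_zero, map_zero, add_zero, add_assoc, ZModModule.add_self,
    add_zero]

/-- Moving `D J` past `e^1` creates the term `e^2 ∧ D² x`, because `J e^1 = e^2`. The extra term
`e^2 ∧ D³ J x` on the right is zero since `e^2 ∧ J = 0`. -/
theorem twist_modelZero (x : ExteriorAlgebra (ZMod 2) (Fin n → ZMod 2)) :
    twist n (modelZero n x) = modelTwo n (twist n x) := by
  have h1 := extGen_one_mul_firstToSecond
    (inducedDerivation (lowerIndex n) (inducedDerivation (lowerIndex n)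
      (inducedDerivation (lowerIndex n) x)))
  simp only [twist_apply, modelZero_apply, modelTwo_apply, map_add]
  rw [inducedDerivation_mul, inducedDerivation_firstToSecond_extGen, map_add,
    inducedDerivation_extGen_mul le_rfl, inducedDerivation_extGen_mul (Nat.zero_le 1)]
  simp only [lowerIndex_comm_firstToSecond, h1]
  abel

theorem complexBetti_modelTwo (q : ℕ) :
    complexBetti (modelTwo n) q = complexBetti (modelZero n) q := by
  let Φ : ExteriorAlgebra (ZMod 2) (Fin n → ZMod 2) ≃ₗ[ZMod 2]
      ExteriorAlgebra (ZMod 2) (Fin n → ZMod 2) :=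
    LinearEquiv.ofInvolutive (twist n) twist_twist
  have hΦ : ∀ q x, x ∈ ⋀[ZMod 2]^q (Fin n → ZMod 2) → twist n x ∈ ⋀[ZMod 2]^q (Fin n → ZMod 2) :=
    fun q x hx => Submodule.add_mem _ hx (inducedDerivation_mem _ (inducedDerivation_mem _ hx))
  exact (complexBetti_congr Φ hΦ hΦ (twist_modelZero) q).symm

end Model

/-! ## The rank of the differential of `𝔪₀` -/

section Rank

open Module

variable {N : ℕ}

/-- The embedding `tⁱ ↦ e^{N+1-i}` of `𝔽₂[t]/(t^N)` in the span of `e^1, …, e^{N+1}`. -/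
def reverseIncl (N : ℕ) : (Fin N → ZMod 2) →ₗ[ZMod 2] (Fin (N + 1) → ZMod 2) where
  toFun v k := if h : 1 ≤ k.val then v ⟨N - k.val, by omega⟩ else 0
  map_add' v w := by
    ext k
    by_cases h : 1 ≤ k.val <;> simp [h]
  map_smul' c v := by
    ext k
    by_cases h : 1 ≤ k.val <;> simp [h]

/-- The projection along `e^1` that is left inverse to `reverseIncl`. -/
def reverseProj (N : ℕ) : (Fin (N + 1) → ZMod 2) →ₗ[ZMod 2] (Fin N → ZMod 2) where
  toFun w i := w ⟨N - i.val, by omega⟩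
  map_add' _ _ := rfl
  map_smul' _ _ := rfl

theorem reverseIncl_apply (v : Fin N → ZMod 2) (k : Fin (N + 1)) :
    reverseIncl N v k = if h : 1 ≤ k.val then v ⟨N - k.val, by omega⟩ else 0 := rfl

theorem reverseProj_apply (w : Fin (N + 1) → ZMod 2) (i : Fin N) :
    reverseProj N w i = w ⟨N - i.val, by omega⟩ := rfl

theorem reverseProj_reverseIncl (v : Fin N → ZMod 2) : reverseProj N (reverseIncl N v) = v := by
  ext i
  have := i.2
  rw [reverseProj_apply, reverseIncl_apply, dif_pos (by dsimp only; omega)]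
  congr 1
  ext
  dsimp only
  omega

theorem truncShift_reverseProj (w : Fin (N + 1) → ZMod 2) :
    truncShift N (reverseProj N w) = reverseProj N (lowerIndex (N + 1) w) := by
  ext i
  have := i.2
  rw [truncShift_apply, reverseProj_apply, reverseProj_apply, lowerIndex_apply]
  by_cases h : 1 ≤ i.val
  · rw [if_pos h, dif_pos (by dsimp only; omega)]
    congr 1
    ext
    dsimp only
    omega
  · rw [if_neg h, dif_neg (by dsimp only; omega)]

theorem map_reverseProj_reverseIncl (x : ExteriorAlgebra (ZMod 2) (Fin N → ZMod 2)) :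
    ExteriorAlgebra.map (reverseProj N) (ExteriorAlgebra.map (reverseIncl N) x) = x := by
  have h : reverseProj N ∘ₗ reverseIncl N = LinearMap.id :=
    LinearMap.ext reverseProj_reverseIncl
  rw [← AlgHom.comp_apply, ExteriorAlgebra.map_comp_map, h, ExteriorAlgebra.map_id, AlgHom.id_apply]

/-- Dropping `e^1` changes `x` by a multiple of `e^1`, which `e^1 ∧ ·` kills. -/
theorem extGen_zero_mul_map (x : ExteriorAlgebra (ZMod 2) (Fin (N + 1) → ZMod 2)) :
    extGen (N + 1) 0 * x = extGen (N + 1) 0 *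
      ExteriorAlgebra.map (reverseIncl N) (ExteriorAlgebra.map (reverseProj N) x) := by
  induction x using ExteriorAlgebra.induction with
  | algebraMap r => simp
  | ι v =>
    rw [ExteriorAlgebra.map_apply_ι, ExteriorAlgebra.map_apply_ι, ← sub_eq_zero, ← mul_sub,
      ← map_sub, show v - reverseIncl N (reverseProj N v) =
        v 0 • fun j : Fin (N + 1) => if j.val = 0 then 1 else 0 from ?_, map_smul, mul_smul_comm,
      extGen, ExteriorAlgebra.ι_sq_zero, smul_zero]
    ext j
    rw [Pi.sub_apply, Pi.smul_apply, reverseIncl_apply]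
    by_cases h : 1 ≤ j.val
    · rw [dif_pos h, if_neg (by omega), smul_zero, reverseProj_apply, sub_eq_zero]
      congr 1
      ext
      dsimp only
      omega
    · rw [dif_neg h, if_pos (by omega), smul_eq_mul, mul_one, sub_zero]
      congr 1
      ext
      rw [Fin.val_zero]
      omega
  | mul a b ha hb =>
    rw [← mul_assoc, ha, mul_assoc, ExteriorAlgebra.mul_comm_zmod_two _ b, ← mul_assoc, hb,
      map_mul, map_mul, mul_assoc, ExteriorAlgebra.mul_comm_zmod_two (ExteriorAlgebra.map _ _)]
  | add a b ha hb => rw [mul_add, ha, hb, map_add, map_add, mul_add]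

/-- The map `x ↦ e^1 ∧ x` from the exterior algebra without `e^1`. -/
noncomputable def wedgeFirst (N : ℕ) : ExteriorAlgebra (ZMod 2) (Fin N → ZMod 2) →ₗ[ZMod 2]
    ExteriorAlgebra (ZMod 2) (Fin (N + 1) → ZMod 2) :=
  LinearMap.mulLeft (ZMod 2) (extGen (N + 1) 0) ∘ₗ
    (ExteriorAlgebra.map (reverseIncl N)).toLinearMap

theorem wedgeFirst_apply (x : ExteriorAlgebra (ZMod 2) (Fin N → ZMod 2)) :
    wedgeFirst N x = extGen (N + 1) 0 * ExteriorAlgebra.map (reverseIncl N) x := rfl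

theorem wedgeFirst_injective (N : ℕ) : Function.Injective (wedgeFirst N) := by
  -- `δ` extends to contraction with `e_1`, a derivation in characteristic two. It strips off `e^1`
  -- and so yields a left inverse.
  let δ : (Fin (N + 1) → ZMod 2) →ₗ[ZMod 2] ExteriorAlgebra (ZMod 2) (Fin (N + 1) → ZMod 2) :=
    Algebra.linearMap _ _ ∘ₗ LinearMap.proj 0
  have h1 : ∀ x, extDerivation δ (ExteriorAlgebra.map (reverseIncl N) x) = 0 := fun x => by
    rw [extDerivation_map (δ := 0) (reverseIncl N) (fun v => by simp [δ, reverseIncl_apply]) x,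
      leibniz_eq_zero (extDerivation_mul 0) (fun v => by simp [extDerivation_ι]), map_zero]
  refine Function.LeftInverse.injective
    (g := fun y => ExteriorAlgebra.map (reverseProj N) (extDerivation δ y)) fun x => ?_
  dsimp only
  rw [wedgeFirst_apply, extDerivation_mul, h1, mul_zero, add_zero, extGen, extDerivation_ι]
  simp [δ, map_reverseProj_reverseIncl]

theorem modelZero_eq_wedgeFirst (x : ExteriorAlgebra (ZMod 2) (Fin (N + 1) → ZMod 2)) :
    modelZero (N + 1) x = wedgeFirst N
      (inducedDerivation (truncShift N) (ExteriorAlgebra.map (reverseProj N) x)) := by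
  rw [modelZero_apply, extGen_zero_mul_map, wedgeFirst_apply,
    inducedDerivation_map (reverseProj N) truncShift_reverseProj]

theorem finrank_map_modelZero (q N : ℕ) :
    finrank (ZMod 2) ((⋀[ZMod 2]^q (Fin (N + 1) → ZMod 2)).map (modelZero (N + 1))) +
      finrank (ZMod 2) (invariantForms q N) = N.choose q := by
  rw [← finrank_range_truncDerivation q N, ← finrank_map_inducedDerivation]
  have : (⋀[ZMod 2]^q (Fin (N + 1) → ZMod 2)).map (modelZero (N + 1)) =
      ((⋀[ZMod 2]^q (Fin N → ZMod 2)).map (inducedDerivation (truncShift N))).map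
        (wedgeFirst N) := by
    ext y
    constructor
    · rintro ⟨x, hx, rfl⟩
      rw [modelZero_eq_wedgeFirst]
      exact ⟨_, ⟨_, map_mem_exteriorPower _ hx, rfl⟩, rfl⟩
    · rintro ⟨_, ⟨x, hx, rfl⟩, rfl⟩
      refine ⟨ExteriorAlgebra.map (reverseIncl N) x, map_mem_exteriorPower _ hx, ?_⟩
      rw [modelZero_eq_wedgeFirst, map_reverseProj_reverseIncl]
  rw [this, (Submodule.equivMapOfInjective _ (wedgeFirst_injective N) _).finrank_eq]

theorem complexBetti_modelZero (q N : ℕ) : complexBetti (modelZero (N + 1)) q =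
    finrank (ZMod 2) (invariantForms q N) + finrank (ZMod 2) (invariantForms (q + 1) N) := by
  have h := complexBetti_add_finrank (d := modelZero (N + 1)) (fun _ _ => modelZero_mem)
    modelZero_modelZero q
  -- By Pascal's rule the binomials of the two ranks cancel against the dimension of the cochain
  -- space.
  rw [finrank_fin_fun, Nat.choose_succ_succ'] at h
  have h1 := finrank_map_modelZero q N
  have h2 := finrank_map_modelZero (q + 1) N
  omega

end Rank

/-! ## Comparison with the Chevalley–Eilenberg complexes -/

section Comparison

open Module

variable {n : ℕ} {L : Type*} [LieRing L] [LieAlgebra (ZMod 2) L]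

/-- Both differentials are derivations, so an isomorphism of algebras that intertwines them on
one-forms intertwines them everywhere. -/
theorem bettiNumber_eq_complexBetti (b : Basis (Fin n) (ZMod 2) L)
    {d : ExteriorAlgebra (ZMod 2) (Fin n → ZMod 2) →ₗ[ZMod 2]
      ExteriorAlgebra (ZMod 2) (Fin n → ZMod 2)}
    (hd : ∀ x y, d (x * y) = d x * y + x * d y)
    (h : ∀ ξ, ExteriorAlgebra.map b.dualBasis.equivFun.toLinearMap (ceOne b ξ) =
      d (ExteriorAlgebra.ι (ZMod 2) (b.dualBasis.equivFun ξ))) (q : ℕ) :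
    bettiNumber b (q + 1) = complexBetti d q := by
  let β := b.dualBasis.equivFun
  let Φ : ExteriorAlgebra (ZMod 2) (Dual (ZMod 2) L) ≃ₗ[ZMod 2]
      ExteriorAlgebra (ZMod 2) (Fin n → ZMod 2) :=
    LinearEquiv.ofLinearMap (ExteriorAlgebra.map β.toLinearMap).toLinearMap
      (ExteriorAlgebra.map β.symm.toLinearMap).toLinearMap
      (by rw [← AlgHom.comp_toLinearMap, ExteriorAlgebra.map_comp_map, LinearEquiv.comp_symm,
            ExteriorAlgebra.map_id]; rfl)
      (by rw [← AlgHom.comp_toLinearMap, ExteriorAlgebra.map_comp_map, LinearEquiv.symm_comp,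
            ExteriorAlgebra.map_id]; rfl)
  refine complexBetti_congr Φ (fun _ _ => map_mem_exteriorPower _)
    (fun _ _ => map_mem_exteriorPower _) (fun x => ?_) q
  have := leibniz_ext (ExteriorAlgebra.map β.toLinearMap)
    (f := (ExteriorAlgebra.map β.toLinearMap).toLinearMap ∘ₗ ceD b)
    (g := d ∘ₗ (ExteriorAlgebra.map β.toLinearMap).toLinearMap)
    (fun x y => by simp [ceD, extDerivation_mul]) (fun x y => by simp [hd])
    (fun v => by
      rw [LinearMap.comp_apply, LinearMap.comp_apply, AlgHom.toLinearMap_apply,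
        AlgHom.toLinearMap_apply, ceD, extDerivation_ι, ExteriorAlgebra.map_apply_ι]
      exact h v)
  exact LinearMap.congr_fun this x

theorem ι_eq_sum_extGen (u : Fin n → ZMod 2) :
    ExteriorAlgebra.ι (ZMod 2) u = ∑ j, u j • extGen n j.val := by
  conv_lhs => rw [pi_eq_sum_univ' u]
  rw [map_sum]
  refine Finset.sum_congr rfl fun j _ => ?_
  rw [map_smul, extGen]
  congr 2
  ext i
  simp [Pi.single_apply, Fin.ext_iff]

theorem map_ceOne (b : Basis (Fin n) (ZMod 2) L) (ξ : Dual (ZMod 2) L) :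
    ExteriorAlgebra.map b.dualBasis.equivFun.toLinearMap (ceOne b ξ) =
      ∑ i, ∑ j, if i < j then ξ ⁅b i, b j⁆ • (extGen n i.val * extGen n j.val) else 0 := by
  have hb : ∀ i, ExteriorAlgebra.map b.dualBasis.equivFun.toLinearMap
      (ExteriorAlgebra.ι (ZMod 2) (b.coord i)) = extGen n i.val := fun i => by
    rw [ExteriorAlgebra.map_apply_ι, extGen]
    congr 1
    ext j
    simp [Finsupp.single_apply, Fin.ext_iff]
  simp only [ceOne, LinearMap.coe_mk, AddHom.coe_mk, map_sum]
  refine Finset.sum_congr rfl fun i _ => Finset.sum_congr rfl fun j _ => ?_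
  split_ifs
  · rw [map_smul, map_mul, hb, hb]
  · rw [map_zero]

/-- The terms missing from the sum over `k < j` vanish: those with `j < k` by `hu`, the diagonal one
because `e ∧ e = 0`. -/
theorem sum_extGen_mul (k : Fin n) {u : Fin n → ZMod 2} (hu : ∀ j < k, u j = 0) :
    (∑ i : Fin n, ∑ j, if i < j then (if i = k then u j else 0) • (extGen n i.val * extGen n j.val)
      else 0) = extGen n k.val * ExteriorAlgebra.ι (ZMod 2) u := by
  rw [Finset.sum_eq_single k, ι_eq_sum_extGen, Finset.mul_sum]
  · refine Finset.sum_congr rfl fun j _ => ?_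
    rcases lt_trichotomy k j with h | rfl | h
    · rw [if_pos h, if_pos rfl, mul_smul_comm]
    · rw [if_neg (lt_irrefl _), mul_smul_comm, extGen_mul_self, smul_zero]
    · rw [if_neg h.not_gt, hu j h, zero_smul, mul_zero]
  · intro i _ hi
    simp [hi]
  · simp

theorem M0.lie_basis_of_lt {i j : Fin n} (hij : i < j) : ⁅M0.basis n i, M0.basis n j⁆ =
    if h : i.val = 0 ∧ j.val + 1 < n then M0.basis n ⟨j.val + 1, h.2⟩ else 0 := by
  have hlt : i.val < j.val := hij
  split_ifs with h
  · exact M0.lie_basis_one i j _ h.1 (by omega) rfl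
  · funext l
    change _ = (0 : ZMod 2)
    have := l.2
    simp only [M0.bracket_apply, bracketOne, M0.basis_apply, Fin.ext_iff]
    split_ifs <;> first | omega | simp

theorem M2.lie_basis_of_lt {i j : Fin n} (hij : i < j) : ⁅M2.basis n i, M2.basis n j⁆ =
    (if h : i.val = 0 ∧ j.val + 1 < n then M2.basis n ⟨j.val + 1, h.2⟩ else 0) +
      if h : i.val = 1 ∧ j.val + 2 < n then M2.basis n ⟨j.val + 2, h.2⟩ else 0 := by
  have hlt : i.val < j.val := hij
  split_ifs with h h' h'
  · omega
  · rw [add_zero]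
    exact M2.lie_basis_one i j _ h.1 (by omega) rfl
  · rw [zero_add]
    exact M2.lie_basis_two i j _ h'.1 (by omega) rfl
  · rw [add_zero]
    funext l
    change _ = (0 : ZMod 2)
    have := l.2
    simp only [M2.bracket_apply, bracketOne, bracketTwo, M2.basis_apply, Fin.ext_iff]
    split_ifs <;> first | omega | simp

theorem bettiNumber_M0 (hn : 2 ≤ n) (q : ℕ) :
    bettiNumber (M0.basis n) (q + 1) = complexBetti (modelZero n) q := by
  refine bettiNumber_eq_complexBetti _ modelZero_mul (fun ξ => ?_) q
  rw [map_ceOne, modelZero_apply, inducedDerivation_ι]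
  rw [show extGen n 0 = extGen n (⟨0, by omega⟩ : Fin n).val from rfl, ← sum_extGen_mul]
  · refine Finset.sum_congr rfl fun i _ => Finset.sum_congr rfl fun j _ => ?_
    split_ifs with hij hi
    · rw [M0.lie_basis_of_lt hij, lowerIndex_apply]
      have h1 : i.val = 0 := by rw [hi]
      have h2 : i.val < j.val := hij
      by_cases h : j.val + 1 < n
      · rw [dif_pos ⟨h1, h⟩, dif_pos ⟨by omega, h⟩]
        simp
      · rw [dif_neg (by omega), dif_neg (by omega), map_zero]
    · rw [M0.lie_basis_of_lt hij, dif_neg (by rw [Fin.ext_iff] at hi; dsimp only at hi; omega),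
        map_zero]
    · rfl
  · intro j hj
    have : j.val < 0 := hj
    omega

theorem bettiNumber_M2 (hn : 2 ≤ n) (q : ℕ) :
    bettiNumber (M2.basis n) (q + 1) = complexBetti (modelTwo n) q := by
  refine bettiNumber_eq_complexBetti _ modelTwo_mul (fun ξ => ?_) q
  rw [map_ceOne, modelTwo_apply, inducedDerivation_ι, inducedDerivation_ι]
  rw [show extGen n 0 = extGen n (⟨0, by omega⟩ : Fin n).val from rfl,
    show extGen n 1 = extGen n (⟨1, by omega⟩ : Fin n).val from rfl, ← sum_extGen_mul,
    ← sum_extGen_mul, ← Finset.sum_add_distrib]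
  · refine Finset.sum_congr rfl fun i _ => ?_
    rw [← Finset.sum_add_distrib]
    refine Finset.sum_congr rfl fun j _ => ?_
    by_cases hij : i < j
    · have h2 : i.val < j.val := hij
      rw [if_pos hij, if_pos hij, if_pos hij, ← add_smul, M2.lie_basis_of_lt hij, map_add]
      congr 2
      · by_cases h : i.val = 0 ∧ j.val + 1 < n
        · rw [dif_pos h, if_pos (Fin.ext h.1), lowerIndex_apply, dif_pos ⟨by omega, h.2⟩]
          simp
        · rw [dif_neg h, map_zero]
          split_ifs with hi
          · rw [Fin.ext_iff] at hi
            rw [lowerIndex_apply, dif_neg (by dsimp only at hi; omega)]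
          · rfl
      · by_cases h : i.val = 1 ∧ j.val + 2 < n
        · rw [dif_pos h, if_pos (Fin.ext h.1), lowerIndex_apply, dif_pos ⟨by omega, by omega⟩,
            lowerIndex_apply, dif_pos ⟨by simp, h.2⟩]
          simp
        · rw [dif_neg h, map_zero]
          split_ifs with hi
          · rw [Fin.ext_iff] at hi
            rw [lowerIndex_apply]
            split_ifs with h'
            · rw [lowerIndex_apply, dif_neg (by dsimp only at hi ⊢; omega)]
            · rfl
          · rfl
    · simp [hij]
  · intro j hj
    have : j.val < 1 := hj
    -- `D² ξ` has no `e^1` component, as wedging with `e^2` requires here.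
    rw [lowerIndex_apply, dif_neg (by omega)]
  · intro j hj
    have : j.val < 0 := hj
    omega

end Comparison

theorem corollary4p1 (n : ℕ) (hn : 5 ≤ n) :
    (∀ q ∈ Finset.Icc 1 3, bettiNumber (M2.basis n) q = bettiNumber (M0.basis n) q) ∧
    bettiNumber (M2.basis n) 1 = 2 ∧
    bettiNumber (M2.basis n) 2 = (n + 1) / 2 ∧
    ∀ p m : ℕ, n = 2 ^ p + m → 0 < m → m ≤ 2 ^ p →
      (bettiNumber (M2.basis n) 3 : ℚ) =
        (2 ^ p - 1) * (2 ^ (p - 1) - 1) / 3 + m * (m - 1) / 2 + ((n - 1) / 2 : ℕ) := by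
  have hM (q : ℕ) : bettiNumber (M2.basis n) (q + 1) = complexBetti (modelZero n) q := by
    rw [bettiNumber_M2 (by omega), complexBetti_modelTwo]
  obtain ⟨N, rfl⟩ : ∃ N, n = N + 1 := ⟨n - 1, by omega⟩
  refine ⟨fun q hq => ?_, ?_, ?_, fun p m hpm hm0 hm => ?_⟩
  · obtain ⟨k, rfl⟩ : ∃ k, q = k + 1 := ⟨q - 1, by have := Finset.mem_Icc.1 hq; omega⟩
    rw [hM, bettiNumber_M0 (by omega)]
  · rw [hM 0, complexBetti_modelZero, finrank_invariantForms_zero,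
      finrank_invariantForms_one (by omega)]
  · rw [hM 1, complexBetti_modelZero, finrank_invariantForms_one (by omega),
      finrank_invariantForms_two]
    omega
  -- `p = 0` would force `n ≤ 2`.
  · obtain ⟨p, rfl⟩ : ∃ k, p = k + 1 := by
      rcases p with _ | p
      · rw [pow_zero] at hpm hm
        omega
      · exact ⟨p, rfl⟩
    -- The forms live on `𝔽₂[t]/(t^N)` with `N = n - 1`, so `0 < m ≤ 2^p` becomes `0 ≤ r < 2^p`.
    obtain ⟨r, rfl⟩ : ∃ r, m = r + 1 := ⟨m - 1, by omega⟩
    obtain rfl : N = 2 ^ (p + 1) + r := by omega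
    have h := finrank_invariantForms_three (p := p + 1) (r := r) (by omega) (by omega)
    rw [hM 2, complexBetti_modelZero, finrank_invariantForms_two, Nat.add_sub_cancel,
      Nat.add_sub_cancel]
    generalize Module.finrank (ZMod 2) (invariantForms 3 (2 ^ (p + 1) + r)) = k at h ⊢
    have h' : 6 * (k : ℚ) = (2 ^ (p + 1) - 1) * (2 ^ (p + 1) - 2) + 3 * r * (r + 1) := by
      exact_mod_cast h
    rw [pow_succ] at h' ⊢
    push_cast
    linear_combination h' / 6
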